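/- **Setting.** Write $[d]=\{0,\dots,d-1\}$ with its natural order. A constraint language $\Gamma$ is a finite set of relations, each given with its own domain $[d]$ and arity $r$, i.e. a set $R\subseteq [d]^r$. $\mathrm{Mo}$ (resp. $\mathrm{Mo}'$) is the family of all monotone (resp. anti-monotone) maps $[n]\to[d]$, for all $n,d$. *The problem.* An instance of Monotone-CSP$(\Gamma)$ is a triple $(n,V,C)$ with $n\in\mathbb N$ given in unary, $V$ a finite set of variables, and $C$ a finite collection of constraints $R(m_1(v_1),\dots,m_r(v_r))$, where $R\in\Gamma$ has arity $r$ and domain $[d]$, $v_i\in V$, and each $m_i:[n]\to[d]$ is monotone. The question is whether some $f:V\to[n]$ satisfies $(m_1(f(v_1)),\dots,m_r(f(v_r)))\in R$ for every constraint. The parameter is $|V|$. *Patterns.* Let $f:[e]^r\to 2^{[e]}$ be a partial multivalued operation (the value $\emptyset$ means undefined) and $\mathcal M$ a map family. On a domain $[d]$, $f$ induces the operation $f_{\mathcal M}$ with $z\in f_{\mathcal M}(y_1,\dots,y_r)$ iff there are a map $m:[e]\to[d]$ in $\mathcal M$ and $x\in[e]^r$, $w\in f(x)$ such that $y_j=m(x_j)$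 for all $j$ and $z=m(w)$. We say that $f$ $\mathcal M$-preserves $\Gamma$ if for every $R\in\Gamma$ and all $t_1,\dots,t_r\in R$, every tuple $z$ with $z[i]\in f_{\mathcal M}(t_1[i],\dots,t_r[i])$ for all coordinates $i$ lies in $R$. Define the patterns (undefined elsewhere) $\mathsf{min}(0,1)=\mathsf{min}(1,0)=0$ and $\mathsf{max}(0,1)=\mathsf{max}(1,0)=1$ on $[2]$, and $\mathsf{con}(0,0,1,2,2)=0$, $\mathsf{con}(0,2,1,0,2)=1$ on $[3]$. The language $\Gamma$ is *domain-reversible* if it is $\mathrm{Mo}$-preserved neither by $\mathsf{min}$ nor by $\mathsf{max}$; it has the *connector property* if $\mathsf{con}$ $(\mathrm{Mo}\cup\mathrm{Mo}')$-preserves $\Gamma$. *W[1]-hardness.* A parameterized problem is a set $L\subseteq\Sigma^*\times\mathbb N$ with $\Sigma$ a finite alphabet. An FPT-reduction from $L_1$ to $L_2$ is a map $P$ with $(x,k)\in L_1\iff P(x,k)\in L_2$, computable in time $f(k)\cdot|x|^{O(1)}$ for some computable $f$, and such that, for some computable $g$, the parameter of $P(x,k)$ is at most $g(k)$. W[1]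 is the class of problems that are FPT-reducible to Independent Set parameterized by the solution size, and $L$ is W[1]-hard if every problem in W[1] is FPT-reducible to $L$. **Theorem.** Let $\Gamma$ be a domain-reversible constraint language. If $\Gamma$ does not have the connector property, then Monotone-CSP$(\Gamma)$, parameterized by the number of variables, is W[1]-hard. -/

import Mathlib

namespace MonoCSP

/-! ## Parameterized problems, a machine model with step count, FPT-reductions -/

/-- A parameterized problem over the alphabet `Fin s`: a subset of `Σ* × ℕ`. -/
abbrev ParamProblem (s : ℕ) := Set (List (Fin s) × ℕ)

/-- The memory of a multi-stack machine: register `r` holds a stack of symbols (top first).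
Symbols are coded by natural numbers; a program mentions only finitely many registers and finitely
many symbols, and cannot create symbols other than those of its input and those it mentions. -/
abbrev Store := ℕ → List ℕ

/-- Programs of the multi-stack machine. -/
inductive Prog where
  /-- do nothing -/
  | skip : Prog
  /-- push the constant symbol `a` on register `r` -/
  | push (r a : ℕ) : Prog
  /-- remove the top symbol of register `r` (no effect if `r` is empty) -/
  | pop (r : ℕ) : Prog
  /-- overwrite register `dst` by a copy of register `src` -/
  | copy (src dst : ℕ) : Prog
  /-- sequential composition -/
  | seq (p q : Prog) : Prog
  /-- run `p` if the top of `r` is `o` (`none` meaning that `r` is empty), else run `q` -/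
  | ite (r : ℕ) (o : Option ℕ) (p q : Prog) : Prog
  /-- repeat `p` until the top of `r` is `o` (`none` meaning that `r` is empty) -/
  | loop (r : ℕ) (o : Option ℕ) (p : Prog) : Prog

/-- `Exec p σ t σ'`: started in `σ`, the program `p` halts in `σ'` after exactly `t` steps.
Stack operations and tests cost one step; copying is charged for the length of the copied string. -/
inductive Exec : Prog → Store → ℕ → Store → Prop where
  | skip (σ : Store) : Exec .skip σ 1 σ
  | push (σ : Store) (r a : ℕ) : Exec (.push r a) σ 1 (Function.update σ r (a :: σ r))
  | pop (σ : Store) (r : ℕ) : Exec (.pop r) σ 1 (Function.update σ r (σ r).tail)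
  | copy (σ : Store) (src dst : ℕ) :
      Exec (.copy src dst) σ ((σ src).length + 1) (Function.update σ dst (σ src))
  | seq {p q : Prog} {σ σ' σ'' : Store} {t t' : ℕ} :
      Exec p σ t σ' → Exec q σ' t' σ'' → Exec (.seq p q) σ (t + t') σ''
  | iteTrue {r : ℕ} {o : Option ℕ} {p q : Prog} {σ σ' : Store} {t : ℕ} :
      (σ r).head? = o → Exec p σ t σ' → Exec (.ite r o p q) σ (t + 1) σ'
  | iteFalse {r : ℕ} {o : Option ℕ} {p q : Prog} {σ σ' : Store} {t : ℕ} :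
      (σ r).head? ≠ o → Exec q σ t σ' → Exec (.ite r o p q) σ (t + 1) σ'
  | loopDone {r : ℕ} {o : Option ℕ} {p : Prog} {σ : Store} :
      (σ r).head? = o → Exec (.loop r o p) σ 1 σ
  | loopStep {r : ℕ} {o : Option ℕ} {p : Prog} {σ σ' σ'' : Store} {t t' : ℕ} :
      (σ r).head? ≠ o → Exec p σ t σ' → Exec (.loop r o p) σ' t' σ'' →
      Exec (.loop r o p) σ (t + t' + 1) σ''

/-- The store presenting `(x, k)`: the string `x` in register 0, the number `k` in unary in
register 1, all other registers empty. Used for inputs and for outputs. -/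
def ioStore {s : ℕ} (I : List (Fin s) × ℕ) : Store := fun r =>
  if r = 0 then I.1.map Fin.val else if r = 1 then List.replicate I.2 1 else []

/-- `P` can be computed in time `f(k) · |x|^O(1)` for a computable function `f`
(`|x| + 1` instead of `|x|` only matters for the empty string). -/
def ComputableInFPTTime {s t : ℕ} (P : List (Fin s) × ℕ → List (Fin t) × ℕ) : Prop :=
  ∃ (p : Prog) (f : ℕ → ℕ) (c : ℕ), Computable f ∧
    ∀ (x : List (Fin s)) (k : ℕ), ∃ time : ℕ,
      time ≤ f k * (x.length + 1) ^ c ∧ Exec p (ioStore (x, k)) time (ioStore (P (x, k)))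

/-- `L₁ ≤_FPT L₂`. -/
def FPTReducible {s t : ℕ} (L₁ : ParamProblem s) (L₂ : ParamProblem t) : Prop :=
  ∃ P : List (Fin s) × ℕ → List (Fin t) × ℕ,
    (∀ I, I ∈ L₁ ↔ P I ∈ L₂) ∧
    ComputableInFPTTime P ∧
    ∃ g : ℕ → ℕ, Computable g ∧ ∀ (x : List (Fin s)) (k : ℕ), (P (x, k)).2 ≤ g k

/-- The number `m` as the self-delimiting binary string `1^m 0`. -/
def unary (m : ℕ) : List (Fin 2) := List.replicate m 1 ++ [0]

open Classical in
/-- A graph as a binary string: the number of vertices, then the strict lower triangle of the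
adjacency matrix, row by row. -/
noncomputable def encodeGraph {n : ℕ} (G : SimpleGraph (Fin n)) : List (Fin 2) :=
  unary n ++ (List.finRange n).flatMap fun v =>
    ((List.finRange n).filter (· < v)).map fun u => if G.Adj u v then 1 else 0

/-- Independent Set, parameterized by the size `k ≥ 1` of the solution. -/
def IndependentSet : ParamProblem 2 :=
  {I | 1 ≤ I.2 ∧ ∃ (n : ℕ) (G : SimpleGraph (Fin n)), I.1 = encodeGraph G ∧
    ∃ S : Finset (Fin n), G.IsNIndepSet I.2 S}

/-- Membership in the class `W[1]`. -/
def InW1 {s : ℕ} (L : ParamProblem s) : Prop := FPTReducible L IndependentSet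

/-- `W[1]`-hardness: every problem in `W[1]` has an FPT-reduction to `L`. -/
def W1Hard {t : ℕ} (L : ParamProblem t) : Prop :=
  ∀ (s : ℕ) (L' : ParamProblem s), InW1 L' → FPTReducible L' L

/-! ## Relations, constraint languages, map families, unbounded-domain CSPs -/

/-- A relation together with its domain `{0, …, dom - 1}` and its arity. -/
structure Rel where
  dom : ℕ
  arity : ℕ
  tuples : Set (Fin arity → Fin dom)

/-- A constraint language: finitely many relations, each with its own domain. -/
abbrev Language := List Rel

/-- A map family: for all `d` and `n` a set of maps `{0, …, n - 1} → {0, …, d - 1}`. -/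
abbrev MapFamily := (d n : ℕ) → Set (Fin n → Fin d)

/-- All monotone maps. -/
def Mo : MapFamily := fun _ _ => {m | Monotone m}

/-- All anti-monotone maps. -/
def Mo' : MapFamily := fun _ _ => {m | Antitone m}

/-- A functionally guarded constraint `R(m₁(v₁), …, m_r(v_r))` over variables `0, …, k - 1` with
domain `{0, …, n - 1}`, with `R` in `Γ` and all maps from the family `M`. -/
structure GuardedConstraint (Γ : Language) (M : MapFamily) (n k : ℕ) where
  rel : Fin Γ.length
  vars : Fin (Γ.get rel).arity → Fin k
  maps : Fin (Γ.get rel).arity → Fin n → Fin (Γ.get rel).dom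
  maps_mem : ∀ i, maps i ∈ M (Γ.get rel).dom n

/-- An instance `(n, V, C)` of `udCSP(Γ, M)`, with `V = {0, …, k - 1}`. -/
structure UdInstance (Γ : Language) (M : MapFamily) where
  n : ℕ
  k : ℕ
  constraints : List (GuardedConstraint Γ M n k)

/-- The instance has a solution. -/
def UdInstance.Satisfiable {Γ : Language} {M : MapFamily} (I : UdInstance Γ M) : Prop :=
  ∃ f : Fin I.k → Fin I.n, ∀ c ∈ I.constraints,
    (fun i => c.maps i (f (c.vars i))) ∈ (Γ.get c.rel).tuples

/-- A constraint as a binary string: the index of its relation, then for each argument the variable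
and the table of values of the map. -/
def GuardedConstraint.encode {Γ : Language} {M : MapFamily} {n k : ℕ}
    (c : GuardedConstraint Γ M n k) : List (Fin 2) :=
  unary c.rel ++ (List.finRange (Γ.get c.rel).arity).flatMap fun i =>
    unary (c.vars i) ++ (List.finRange n).flatMap fun a => unary (c.maps i a)

/-- An instance as a binary string; the domain size is given in unary. -/
def UdInstance.encode {Γ : Language} {M : MapFamily} (I : UdInstance Γ M) : List (Fin 2) :=
  unary I.n ++ unary I.k ++ I.constraints.flatMap GuardedConstraint.encode

/-- `udCSP(Γ, M)`, parameterized by the number of variables. -/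
def udCSP (Γ : Language) (M : MapFamily) : ParamProblem 2 :=
  {x | ∃ I : UdInstance Γ M, x = (I.encode, I.k) ∧ I.Satisfiable}

/-- `Monotone-CSP(Γ)`, parameterized by the number of variables. -/
def MonotoneCSP (Γ : Language) : ParamProblem 2 := udCSP Γ Mo

/-! ## Pattern polymorphisms -/

/-- An `r`-ary partial multivalued operation on `D`; the value `∅` means undefined. -/
abbrev MultiOp (D : Type) (r : ℕ) := (Fin r → D) → Set D

/-- The concrete homomorphic image `f_M`: it is generated by
`f_M(m(x₁), …, m(x_r)) ⊇ m(f(x₁, …, x_r))` for `m ∈ M`. -/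
def homImage {D E : Type} {r : ℕ} (f : MultiOp D r) (M : Set (D → E)) : MultiOp E r :=
  fun y => {z | ∃ m ∈ M, ∃ x : Fin r → D, (fun j => m (x j)) = y ∧ z ∈ m '' f x}

/-- `f` preserves the relation `R` on `E`: applying `f` coordinatewise to tuples of `R` gives only
tuples of `R`. -/
def Preserves {E : Type} {r a : ℕ} (f : MultiOp E r) (R : Set (Fin a → E)) : Prop :=
  ∀ t : Fin r → Fin a → E, (∀ j, t j ∈ R) →
    ∀ z : Fin a → E, (∀ i, z i ∈ f fun j => t j i) → z ∈ R

/-- The pattern `f` on `{0, …, e - 1}` `M`-preserves the language `Γ`, i.e. `f ∈ mPol(Γ, M)`. -/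
def FamilyPreserves {e r : ℕ} (M : MapFamily) (f : MultiOp (Fin e) r) (Γ : Language) : Prop :=
  ∀ R ∈ Γ, Preserves (homImage f (M R.dom e)) R.tuples

/-- The pattern `min(0,1) = min(1,0) = 0`. -/
def minPattern : MultiOp (Fin 2) 2 := fun x => {y | (x = ![0, 1] ∨ x = ![1, 0]) ∧ y = 0}

/-- The pattern `max(0,1) = max(1,0) = 1`. -/
def maxPattern : MultiOp (Fin 2) 2 := fun x => {y | (x = ![0, 1] ∨ x = ![1, 0]) ∧ y = 1}

/-- The connector pattern `con(0,0,1,2,2) = 0`, `con(0,2,1,0,2) = 1`. -/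
def conPattern : MultiOp (Fin 3) 5 := fun x =>
  {y | (x = ![0, 0, 1, 2, 2] ∧ y = 0) ∨ (x = ![0, 2, 1, 0, 2] ∧ y = 1)}

/-- `Γ` is domain-reversible: it is `Mo`-preserved neither by `min` nor by `max`. -/
def DomainReversible (Γ : Language) : Prop :=
  ¬ FamilyPreserves Mo minPattern Γ ∧ ¬ FamilyPreserves Mo maxPattern Γ

/-- The connector property: `con ∈ mPol(Γ, Mo ∪ Mo')`. -/
def ConnectorProperty (Γ : Language) : Prop :=
  FamilyPreserves (fun d n => Mo d n ∪ Mo' d n) conPattern Γ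

end MonoCSP

/-!
An FPT-reduction from Independent Set to `MonotoneCSP Γ` is built; composing it with any reduction to
Independent Set (`FPTReducible.trans`) gives `W[1]`-hardness.

**Gadgets.** If `min` does not preserve `R ∈ Γ`, some two tuples of `R` have their coordinatewise
minimum outside `R`. Reading the coordinates through threshold maps yields a Boolean relation that
contains `(0, 1)` and `(1, 0)` but not `(0, 0)`; dually for `max`. Together they express
`x ≥ a ↔ ¬ y ≥ b` (`exists_xorTemplates`). With `b = N - a` for all `a` this forces
`y = N - 1 - x`, so every variable gets a reversed copy, and antitone maps of a variable become
available as monotone maps of its copy. A failure of `con` for monotone and antitone maps therefore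
gives a relation on `{0, 1, 2}²` that contains the corners and the centre but not `(0, 1)`. Its
conjunction with its images under reversals and the swap of the arguments is `a = 1 ↔ b = 1`
(`exists_iffTemplates`). Composed with the monotone maps `level lo hi` onto `{0, 1, 2}`, it becomes
the constraint `x ∈ [lo, hi) ↔ y ∈ [lo', hi')` for arbitrary intervals.

**Hardness of interval equivalences.** For a graph on `n` vertices and a number `k`, take variables
`z i j` for `i, j < k` with domain `{0, …, n² - 1}`, where `z i j = a * n + b` means that `a` and `b`
are the `i`-th and the `j`-th chosen vertex. The values with a given `a` form an interval, so
interval equivalences can say that `a` depends on `i` only; singletons are intervals, so they can say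
`z i j = a * n + b ↔ z j i = b * n + a`; and comparing with an empty interval excludes the pairs of
equal or adjacent vertices for `i ≠ j`. Solutions correspond to independent sets
(`IsSolution.exists_isNIndepSet`, `exists_isSolution`). With the reversed copies there are `2 * k²`
variables.

**Computation.** The output is described by an `Emitter`, an expression built from bounded loops,
comparisons and tests of input symbols. Emitters compile to programs of the stack machine, with a
polynomial time bound obtained by recursion on the expression (`Emitter.run_compile`). That an
emitter denotes the code of an instance with the intended solutions is shown piece by piece through
the predicate `Encodes`, which is closed under concatenation and bounded loops.
-/

namespace MonoCSP

open Polynomial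

/-! ### Transitivity of FPT-reductions -/

/-- In `t` steps a program lengthens the longest register by at most `t`: pushing adds one symbol,
and copying only duplicates strings that are already present. -/
theorem Exec.length_le {p : Prog} {σ σ' : Store} {t : ℕ} (h : Exec p σ t σ') {B : ℕ}
    (hB : ∀ r, (σ r).length ≤ B) : ∀ r, (σ' r).length ≤ B + t := by
  induction h generalizing B with
  | skip σ => exact fun r => (hB r).trans (Nat.le_add_right _ _)
  | push σ r a =>
    intro r'
    have := hB r; have := hB r'
    by_cases h : r' = r
    · subst h; simp; omega
    · simp [h]; omega
  | pop σ r =>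
    intro r'
    have := hB r; have := hB r'
    by_cases h : r' = r
    · subst h; simp; omega
    · simp [h]; omega
  | copy σ s d =>
    intro r'
    have := hB s; have := hB r'
    by_cases h : r' = d
    · subst h; simp; omega
    · simp [h]; omega
  | seq _ _ ih₁ ih₂ => intro r; have := ih₂ (ih₁ hB) r; omega
  | iteTrue _ _ ih => intro r; have := ih hB r; omega
  | iteFalse _ _ ih => intro r; have := ih hB r; omega
  | loopDone _ => exact fun r => (hB r).trans (Nat.le_add_right _ _)
  | loopStep _ _ _ ih₁ ih₂ => intro r; have := ih₂ (ih₁ hB) r; omega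

theorem length_ioStore_le {s : ℕ} (I : List (Fin s) × ℕ) (r : ℕ) :
    (ioStore I r).length ≤ I.1.length + I.2 := by
  unfold ioStore
  split_ifs <;> simp

theorem computable_add {f g : ℕ → ℕ} (hf : Computable f) (hg : Computable g) :
    Computable fun n => f n + g n := Primrec.nat_add.to_comp.comp hf hg

theorem computable_mul {f g : ℕ → ℕ} (hf : Computable f) (hg : Computable g) :
    Computable fun n => f n * g n := Primrec.nat_mul.to_comp.comp hf hg

theorem computable_pow {f : ℕ → ℕ} (hf : Computable f) (c : ℕ) :
    Computable fun n => f n ^ c := by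
  induction c with
  | zero => simpa using Computable.const 1
  | succ c ih => simpa [pow_succ] using computable_mul ih hf

theorem computable_sum_range_succ {f : ℕ → ℕ} (hf : Computable f) :
    Computable fun n => ∑ j ∈ Finset.range (n + 1), f j := by
  have h : Computable₂ fun (_ : ℕ) (q : ℕ × ℕ) => q.2 + f (q.1 + 1) := by
    refine Primrec.nat_add.to_comp.comp (Computable.snd.comp Computable.snd) (hf.comp ?_)
    exact Primrec.succ.to_comp.comp (Computable.fst.comp Computable.snd)
  refine (Computable.nat_rec Computable.id (Computable.const (f 0)) h).of_eq fun n => ?_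
  simp only [id]
  induction n with
  | zero => simp
  | succ n ih => rw [Finset.sum_range_succ, ← ih]

theorem le_sum_range_succ (f : ℕ → ℕ) {m n : ℕ} (h : m ≤ n) :
    f m ≤ ∑ j ∈ Finset.range (n + 1), f j :=
  Finset.single_le_sum (f := f) (fun _ _ => Nat.zero_le _) (Finset.mem_range.2 (by omega))

/-- Running the two programs one after the other works because the output conventions of the first
are the input conventions of the second. The bounds of the second reduction need not be monotone
in the parameter and are replaced by their partial sums. -/
theorem FPTReducible.trans {s t u : ℕ} {L₁ : ParamProblem s} {L₂ : ParamProblem t}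
    {L₃ : ParamProblem u} (h₁ : FPTReducible L₁ L₂) (h₂ : FPTReducible L₂ L₃) :
    FPTReducible L₁ L₃ := by
  obtain ⟨P, hP, ⟨p, f, c, hf, hp⟩, g, hg, hPg⟩ := h₁
  obtain ⟨Q, hQ, ⟨q, f', c', hf', hq⟩, g', hg', hQg⟩ := h₂
  let F : ℕ → ℕ := fun n => ∑ j ∈ Finset.range (n + 1), f' j
  let G : ℕ → ℕ := fun n => ∑ j ∈ Finset.range (n + 1), g' j
  refine ⟨Q ∘ P, fun I => (hP I).trans (hQ _), ⟨.seq p q,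
    fun k => f k + F (g k) * (1 + k + f k) ^ c', c + (c + 1) * c', ?_, fun x k => ?_⟩,
    fun k => G (g k), (computable_sum_range_succ hg').comp hg, fun x k => ?_⟩
  · refine computable_add hf (computable_mul ((computable_sum_range_succ hf').comp hg) ?_)
    exact computable_pow (computable_add (computable_add (Computable.const 1) Computable.id) hf) c'
  · obtain ⟨T, hT, hpT⟩ := hp x k
    obtain ⟨T', hT', hqT⟩ := hq (P (x, k)).1 (P (x, k)).2
    refine ⟨T + T', ?_, .seq hpT hqT⟩
    have hlen : (P (x, k)).1.length ≤ x.length + k + T := by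
      simpa [ioStore] using hpT.length_le (length_ioStore_le (x, k)) 0
    set M := x.length + 1
    have hM : 1 ≤ M := by simp [M]
    have hMc : 1 ≤ M ^ c := Nat.one_le_pow _ _ hM
    have hy : (P (x, k)).1.length + 1 ≤ (1 + k + f k) * M ^ (c + 1) := by
      have h1 : M ≤ M ^ (c + 1) := Nat.le_self_pow (by omega) M
      have h2 : M ^ c ≤ M ^ (c + 1) := Nat.pow_le_pow_right hM (by omega)
      have h3 : f k * M ^ c ≤ f k * M ^ (c + 1) := Nat.mul_le_mul_left _ h2
      have h4 : k ≤ k * M ^ (c + 1) := Nat.le_mul_of_pos_right k (by positivity)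
      calc (P (x, k)).1.length + 1 ≤ M + k + f k * M ^ c := by omega
        _ ≤ _ := by rw [add_mul, add_mul, one_mul]; omega
    have hMM : M ^ c ≤ M ^ (c + (c + 1) * c') := Nat.pow_le_pow_right hM (by omega)
    have hMM' : M ^ ((c + 1) * c') ≤ M ^ (c + (c + 1) * c') := Nat.pow_le_pow_right hM (by omega)
    calc T + T' ≤ f k * M ^ c
          + F (g k) * ((1 + k + f k) * M ^ (c + 1)) ^ c' := by
          refine add_le_add hT (hT'.trans ?_)
          exact Nat.mul_le_mul (le_sum_range_succ f' (hPg x k)) (Nat.pow_le_pow_left hy c')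
      _ = f k * M ^ c + F (g k) * (1 + k + f k) ^ c' * M ^ ((c + 1) * c') := by
          rw [mul_pow, ← pow_mul, mul_assoc]
      _ ≤ _ := (add_le_add (Nat.mul_le_mul_left _ hMM) (Nat.mul_le_mul_left _ hMM')).trans_eq
          (add_mul _ _ _).symm
  · exact (hQg _ _).trans (le_sum_range_succ g' (hPg x k))

/-! ### Running programs within a time bound -/

/-- Started in `σ`, the program `p` halts in `σ'` after at most `T` steps. -/
def Run (p : Prog) (σ σ' : Store) (T : ℕ) : Prop := ∃ t ≤ T, Exec p σ t σ'

theorem Run.mono {p : Prog} {σ σ' : Store} {T T' : ℕ} (h : Run p σ σ' T) (hT : T ≤ T') :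
    Run p σ σ' T' := by
  obtain ⟨t, ht, he⟩ := h
  exact ⟨t, ht.trans hT, he⟩

theorem Run.seq {p q : Prog} {σ σ' σ'' : Store} {T T' : ℕ} (h : Run p σ σ' T)
    (h' : Run q σ' σ'' T') : Run (.seq p q) σ σ'' (T + T') := by
  obtain ⟨t, ht, he⟩ := h
  obtain ⟨t', ht', he'⟩ := h'
  exact ⟨t + t', add_le_add ht ht', .seq he he'⟩

theorem Run.copy {σ : Store} {r d T : ℕ} (h : (σ r).length ≤ T) :
    Run (.copy r d) σ (Function.update σ d (σ r)) (T + 1) :=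
  ⟨_, Nat.succ_le_succ h, .copy σ r d⟩

theorem Run.push (σ : Store) (r a : ℕ) :
    Run (.push r a) σ (Function.update σ r (a :: σ r)) 1 := ⟨1, le_rfl, .push σ r a⟩

theorem Run.pop (σ : Store) (r : ℕ) :
    Run (.pop r) σ (Function.update σ r (σ r).tail) 1 := ⟨1, le_rfl, .pop σ r⟩

theorem Run.ite {p q : Prog} {σ σ' : Store} {r T : ℕ} {o : Option ℕ}
    (h : if (σ r).head? = o then Run p σ σ' T else Run q σ σ' T) :
    Run (.ite r o p q) σ σ' (T + 1) := by
  split_ifs at h with hc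
  · obtain ⟨t, ht, he⟩ := h
    exact ⟨t + 1, by omega, .iteTrue hc he⟩
  · obtain ⟨t, ht, he⟩ := h
    exact ⟨t + 1, by omega, .iteFalse hc he⟩

/-- A loop that pops its counter register `c` once per round: `F i` is the store when the counter
has length `i`. -/
theorem Run.loop {p : Prog} {c T : ℕ} (F : ℕ → Store) (n : ℕ)
    (hF : ∀ i ≤ n, (F i c).length = i) (h : ∀ i < n, Run p (F (i + 1)) (F i) T) :
    Run (.loop c none p) (F n) (F 0) (n * (T + 1) + 1) := by
  induction n with
  | zero =>
    refine ⟨1, by omega, .loopDone ?_⟩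
    have := hF 0 le_rfl
    simpa using this
  | succ n ih =>
    obtain ⟨t, ht, he⟩ := h n (by omega)
    obtain ⟨t', ht', he'⟩ := ih (fun i hi => hF i (by omega)) fun i hi => h i (by omega)
    refine ⟨t + t' + 1, by rw [add_mul]; omega, .loopStep ?_ he he'⟩
    intro h0
    have := hF (n + 1) le_rfl
    simp at h0
    simp [h0] at this

/-! ### A language of emitters -/

/-- Expressions denoting binary strings that depend on an input string `x` and on finitely many
numbers. Variables are de Bruijn levels: `r` refers to the `r`-th entry of the environment, and a
binder appends an entry at the end. -/
inductive Emitter where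
  /-- the empty string -/
  | nil : Emitter
  /-- a single symbol -/
  | sym (a : Fin 2) : Emitter
  /-- concatenation -/
  | cat (e f : Emitter) : Emitter
  /-- concatenation of the values of `e` for the new variable running through all numbers below the
  value of `r` -/
  | loop (r : ℕ) (e : Emitter) : Emitter
  /-- the value of `f` for the new variable being the length of `e`; in `e` this level is reserved
  and has value `0` -/
  | len (e f : Emitter) : Emitter
  /-- `e` if the value of `i` is less than that of `r`, else `f` -/
  | lt (i r : ℕ) (e f : Emitter) : Emitter
  /-- `e` if the symbol of the input at the position given by `i` is `1`, else `f` -/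
  | bit (i : ℕ) (e f : Emitter) : Emitter

namespace Emitter

/-- The string denoted by an emitter on the input `x` in the environment `env`; variables outside
the environment have value `0`. -/
def denote (x : List (Fin 2)) : Emitter → List ℕ → List (Fin 2)
  | nil, _ => []
  | sym a, _ => [a]
  | cat e f, env => denote x e env ++ denote x f env
  | loop r e, env => (List.range (env.getD r 0)).flatMap fun i => denote x e (env ++ [i])
  | len e f, env => denote x f (env ++ [(denote x e (env ++ [0])).length])
  | lt i r e f, env => if env.getD i 0 < env.getD r 0 then denote x e env else denote x f env
  | bit i e f, env => if x[env.getD i 0]? = some 1 then denote x e env else denote x f env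

/-- Leaves in register `2 * D + 3` the content of register `2 * r` without as many symbols as
register `2 * i` holds. The copies are kept in odd registers, so that no variable is overwritten. -/
def dropProg (D i r : ℕ) : Prog :=
  .seq (.copy (2 * i) (2 * D + 1)) (.seq (.copy (2 * r) (2 * D + 3))
    (.loop (2 * D + 1) none (.seq (.pop (2 * D + 1)) (.pop (2 * D + 3)))))

/-- The program that pushes the string denoted by an emitter on register `2 * o + 1`. The variable
`r` is held in register `2 * r`, as the length of its content; `D` is the length of the environment.
The parts of a concatenation are run from right to left, since a stack is written back to front, and
loops count downwards. Registers are cleared by copying an empty register. -/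
def compile : Emitter → ℕ → ℕ → Prog
  | nil, _, _ => .skip
  | sym a, _, o => .push (2 * o + 1) a
  | cat e f, D, o => .seq (compile f D o) (compile e D o)
  | loop r e, D, o => .seq (.copy (2 * r) (2 * D))
      (.loop (2 * D) none (.seq (.pop (2 * D)) (compile e (D + 1) o)))
  | len e f, D, o => .seq (compile e (D + 1) D) (.seq (.copy (2 * D + 1) (2 * D))
      (.seq (.copy (2 * D + 2) (2 * D + 1)) (.seq (compile f (D + 1) o)
        (.copy (2 * D + 1) (2 * D)))))
  | lt i r e f, D, o => .seq (dropProg D i r) (.ite (2 * D + 3) none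
      (.seq (.copy (2 * D + 1) (2 * D + 3)) (compile f D o))
      (.seq (.copy (2 * D + 1) (2 * D + 3)) (compile e D o)))
  | bit i e f, D, o => .seq (dropProg D i 0) (.ite (2 * D + 3) (some 1)
      (.seq (.copy (2 * D + 1) (2 * D + 3)) (compile e D o))
      (.seq (.copy (2 * D + 1) (2 * D + 3)) (compile f D o)))

/-- The running time of the compiled emitter, as a polynomial in a bound on the variables. -/
noncomputable def cost : Emitter → ℕ[X]
  | nil => 1
  | sym _ => 1
  | cat e f => cost f + cost e
  | loop _ e => X + 1 + (X * (1 + cost e + 1) + 1)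
  | len e f => cost e + (cost e + 1 + (1 + ((cost f).comp (X + cost e) + 1)))
  | lt _ _ e f => (X + 1 + (X + 1 + (X * 3 + 1))) + (1 + (cost e + cost f) + 1)
  | bit _ e f => (X + 1 + (X + 1 + (X * 3 + 1))) + (1 + (cost e + cost f) + 1)

/-- The store `σ` represents the input `x` and the environment `env`; scratch registers are
empty. -/
structure Rep (x : List (Fin 2)) (env : List ℕ) (σ : Store) : Prop where
  input : σ 0 = x.map Fin.val
  len : ∀ r, (σ (2 * r)).length = env.getD r 0
  odd : ∀ r, env.length ≤ r → σ (2 * r + 1) = []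

variable {x : List (Fin 2)} {env : List ℕ} {σ : Store}

theorem Rep.update_odd (h : Rep x env σ) {o : ℕ} (ho : o < env.length) (l : List ℕ) :
    Rep x env (Function.update σ (2 * o + 1) l) where
  input := by simpa using h.input
  len r := by rw [Function.update_of_ne (by omega)]; exact h.len r
  odd r hr := by rw [Function.update_of_ne (by omega)]; exact h.odd r hr

theorem Rep.append (h : Rep x env σ) (h0 : 0 < env.length) {l : List ℕ} {a : ℕ}
    (hl : l.length = a) : Rep x (env ++ [a]) (Function.update σ (2 * env.length) l) where
  input := by rw [Function.update_of_ne (by omega)]; exact h.input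
  len r := by
    rcases lt_trichotomy r env.length with hr | rfl | hr
    · rw [Function.update_of_ne (by omega), h.len, List.getD_append _ _ _ _ hr]
    · simp [hl]
    · rw [Function.update_of_ne (by omega), h.len, List.getD_eq_default _ _ hr.le,
        List.getD_eq_default]
      simpa using hr
  odd r hr := by
    rw [Function.update_of_ne (by omega)]
    exact h.odd r (by simp at hr; omega)

theorem Rep.even_eq_nil (h : Rep x env σ) {r : ℕ} (hr : env.length ≤ r) : σ (2 * r) = [] := by
  have := h.len r
  rwa [List.getD_eq_default _ _ hr, List.length_eq_zero_iff] at this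

theorem getD_le {B : ℕ} (hB : ∀ a ∈ env, a ≤ B) (r : ℕ) : env.getD r 0 ≤ B := by
  by_cases hr : r < env.length
  · rw [List.getD_eq_getElem _ _ hr]; exact hB _ (List.getElem_mem hr)
  · rw [List.getD_eq_default _ _ (by omega)]; exact Nat.zero_le _

theorem Rep.run_dropProg (h : Rep x env σ) {B : ℕ} (hB : ∀ a ∈ env, a ≤ B) (i r : ℕ) :
    Run (dropProg env.length i r) σ
      (Function.update σ (2 * env.length + 3) ((σ (2 * r)).drop (env.getD i 0)))
      (B + 1 + (B + 1 + (B * 3 + 1))) := by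
  set D := env.length with hD
  set n := env.getD i 0 with hn
  have hi := h.len i
  have h1 : σ (2 * D + 1) = [] := h.odd D le_rfl
  have h3 : σ (2 * D + 3) = [] := h.odd (D + 1) (by omega)
  let F : ℕ → Store := fun m => Function.update (Function.update σ (2 * D + 1)
    ((σ (2 * i)).drop (n - m))) (2 * D + 3) ((σ (2 * r)).drop (n - m))
  have hloop : Run (.loop (2 * D + 1) none (.seq (.pop (2 * D + 1)) (.pop (2 * D + 3)))) (F n) (F 0)
      (n * (2 + 1) + 1) := by
    refine Run.loop F n (fun m hm => ?_) fun m hm => ?_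
    · simp only [F]
      rw [Function.update_of_ne (by omega), Function.update_self, List.length_drop, hi]
      omega
    · convert (Run.pop (F (m + 1)) (2 * D + 1)).seq (Run.pop _ (2 * D + 3)) using 1
      have e1 : n - m = n - (m + 1) + 1 := by omega
      funext q
      by_cases hq3 : q = 2 * D + 3
      · subst hq3; simp [F, e1]
      · by_cases hq1 : q = 2 * D + 1
        · subst hq1; simp [F, e1]
        · simp [F, hq1, hq3]
  have hc1 := Run.copy (σ := σ) (r := 2 * i) (d := 2 * D + 1) (hi.le.trans (getD_le hB i))
  have hc2 := Run.copy (σ := Function.update σ (2 * D + 1) (σ (2 * i))) (r := 2 * r)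
    (d := 2 * D + 3) (T := B)
    (by rw [Function.update_of_ne (by omega), h.len]; exact getD_le hB r)
  have hFn : F n = Function.update (Function.update σ (2 * D + 1) (σ (2 * i))) (2 * D + 3)
      (Function.update σ (2 * D + 1) (σ (2 * i)) (2 * r)) := by
    rw [Function.update_of_ne (a := 2 * r) (by omega)]; simp [F]
  have hF0 : F 0 = Function.update σ (2 * D + 3) ((σ (2 * r)).drop n) := by
    have : (σ (2 * i)).drop n = σ (2 * D + 1) := by
      rw [h1, List.drop_eq_nil_iff]; exact hi.le
    simp [F, this]
  rw [hFn] at hloop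
  rw [← hF0]
  refine hc1.seq (hc2.seq (hloop.mono ?_))
  have := Nat.mul_le_mul_right 3 (getD_le hB i)
  simp only [← hn] at this
  omega

/-- Both conditionals leave the tested string in register `2 * D + 3`; each branch starts by
emptying it. -/
theorem Rep.run_branch (h : Rep x env σ) {l : List ℕ} {p : Prog} {σ' : Store} {T : ℕ}
    (hp : Run p σ σ' T) :
    Run (.seq (.copy (2 * env.length + 1) (2 * env.length + 3)) p)
      (Function.update σ (2 * env.length + 3) l) σ' (1 + T) := by
  have h1 : σ (2 * env.length + 1) = [] := h.odd _ le_rfl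
  have h3 : σ (2 * env.length + 3) = [] := h.odd (env.length + 1) (by omega)
  have hc := Run.copy (σ := Function.update σ (2 * env.length + 3) l) (r := 2 * env.length + 1)
    (d := 2 * env.length + 3) (T := 0) (by simp [h1])
  have : Function.update (Function.update σ (2 * env.length + 3) l) (2 * env.length + 3)
      (Function.update σ (2 * env.length + 3) l (2 * env.length + 1)) = σ := by
    funext q
    by_cases hq : q = 2 * env.length + 3
    · subst hq; simp [h1, h3]
    · simp [hq]
  rw [this] at hc
  exact hc.seq hp

/-- The compiled emitter pushes the denoted string on its target register and changes nothing
else. -/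
theorem run_compile (e : Emitter) : ∀ {env : List ℕ} {σ : Store} {o B : ℕ}, Rep x env σ →
    o < env.length → (∀ a ∈ env, a ≤ B) →
    (denote x e env).length ≤ (cost e).eval B ∧
    Run (compile e env.length o) σ
      (Function.update σ (2 * o + 1) ((denote x e env).map Fin.val ++ σ (2 * o + 1)))
      ((cost e).eval B) := by
  induction e with
  | nil =>
    intro env σ o B h ho hB
    refine ⟨by simp [denote], ?_⟩
    have hskip : Run .skip σ σ 1 := ⟨1, le_rfl, .skip σ⟩
    simpa [denote, compile, cost] using hskip
  | sym a =>
    intro env σ o B h ho hB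
    refine ⟨by simp [denote, cost], ?_⟩
    simpa [denote, compile, cost] using Run.push σ (2 * o + 1) a
  | cat e f ihe ihf =>
    intro env σ o B h ho hB
    obtain ⟨hf1, hf2⟩ := ihf h ho hB
    obtain ⟨he1, he2⟩ := ihe (h.update_odd ho ((denote x f env).map Fin.val ++ σ (2 * o + 1))) ho hB
    refine ⟨by simp [denote, cost]; omega, ?_⟩
    simpa [denote, compile, cost] using hf2.seq he2
  | loop r e ih =>
    intro env σ o B h ho hB
    set n := env.getD r 0 with hn
    have hnB : n ≤ B := getD_le hB r
    have hr := h.len r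
    set D := env.length with hD
    set g : ℕ → List (Fin 2) := fun i => denote x e (env ++ [i]) with hg
    -- The store when the loop variable has value `m`: the rounds `m, …, n - 1` have been emitted.
    let F : ℕ → Store := fun m => Function.update (Function.update σ (2 * D)
      ((σ (2 * r)).drop (n - m))) (2 * o + 1)
      ((((List.range n).drop m).flatMap g).map Fin.val ++ σ (2 * o + 1))
    have hB' : ∀ i < n, ∀ a ∈ env ++ [i], a ≤ B := by
      intro i hi a ha
      rcases List.mem_append.1 ha with ha | ha
      · exact hB a ha
      · simp at ha; omega
    have hrep : ∀ i < n, Rep x (env ++ [i]) (Function.update σ (2 * D) ((σ (2 * r)).drop (n - i))) :=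
      fun i hi => h.append (by omega) (by rw [List.length_drop, hr]; omega)
    refine ⟨?_, ?_⟩
    · have hle : ∀ i < n, (g i).length ≤ (cost e).eval B := fun i hi =>
        (ih (o := o) (hrep i hi) (by simp; omega) (hB' i hi)).1
      have : ((List.range n).flatMap g).length ≤ n * (cost e).eval B := by
        rw [List.length_flatMap]
        refine (List.sum_le_card_nsmul _ ((cost e).eval B) ?_).trans (by simp)
        intro y hy
        simp only [List.mem_map, List.mem_range] at hy
        obtain ⟨i, hi, rfl⟩ := hy
        exact hle i hi
      have h2 := Nat.mul_le_mul_right ((cost e).eval B) hnB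
      have h3 : B * (cost e).eval B ≤ B * (1 + (cost e).eval B + 1) := Nat.mul_le_mul_left _ (by omega)
      simp only [denote, cost, eval_add, eval_mul, eval_X, eval_one, ← hn, ← hg]
      omega
    · have hloop : Run (.loop (2 * D) none (.seq (.pop (2 * D)) (compile e (D + 1) o))) (F n) (F 0)
          (n * ((1 + (cost e).eval B) + 1) + 1) := by
        refine Run.loop F n (fun m hm => ?_) fun m hm => ?_
        · simp only [F]
          rw [Function.update_of_ne (by omega), Function.update_self, List.length_drop, hr]
          omega
        · have hrm := (hrep m hm).update_odd (o := o) (by simp; omega)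
            ((((List.range n).drop (m + 1)).flatMap g).map Fin.val ++ σ (2 * o + 1))
          have hrun := (ih (o := o) hrm (by simp; omega) (hB' m hm)).2
          have hpop := Run.pop (F (m + 1)) (2 * D)
          have e0 : Function.update (F (m + 1)) (2 * D) (F (m + 1) (2 * D)).tail =
              Function.update (Function.update σ (2 * D) ((σ (2 * r)).drop (n - m))) (2 * o + 1)
                ((((List.range n).drop (m + 1)).flatMap g).map Fin.val ++ σ (2 * o + 1)) := by
            have e1 : n - m = n - (m + 1) + 1 := by omega
            have e2 : 2 * D ≠ 2 * o + 1 := by omega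
            funext q
            by_cases hq1 : q = 2 * D
            · subst hq1; simp [F, e1, e2]
            · simp [F, hq1, Function.update_apply]
          rw [e0] at hpop
          have hlen : (env ++ [m]).length = D + 1 := by simp [hD]
          rw [hlen] at hrun
          convert hpop.seq hrun using 1
          have hdrop : (List.range n).drop m = m :: (List.range n).drop (m + 1) := by
            rw [List.drop_eq_getElem_cons (by simpa using hm)]; simp
          simp [F, hdrop, hg]
      have hcopy := Run.copy (σ := σ) (r := 2 * r) (d := 2 * D) (hr.le.trans hnB)
      have hFn : F n = Function.update σ (2 * D) (σ (2 * r)) := by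
        funext q
        by_cases hq1 : q = 2 * o + 1
        · subst hq1
          have e2 : 2 * o + 1 ≠ 2 * D := by omega
          have hnil : (List.range n).drop n = [] := by simp
          simp [F, e2, hnil]
        · simp [F, hq1]
      have hF0 : F 0 = Function.update σ (2 * o + 1)
          ((denote x (loop r e) env).map Fin.val ++ σ (2 * o + 1)) := by
        have : (σ (2 * r)).drop n = σ (2 * D) := by
          rw [h.even_eq_nil le_rfl, List.drop_eq_nil_iff]; exact hr.le
        simp only [F, denote, Nat.sub_zero, List.drop_zero, this, Function.update_eq_self, ← hn, ← hg]
      rw [hFn] at hloop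
      rw [← hF0]
      simp only [compile, cost, eval_add, eval_mul, eval_X, eval_one]
      refine hcopy.seq (hloop.mono ?_)
      exact Nat.succ_le_succ (Nat.mul_le_mul_right _ hnB)
  | len e f ihe ihf =>
    intro env σ o B h ho hB
    set D := env.length with hD
    have hev : σ (2 * D) = [] := h.even_eq_nil le_rfl
    have hev2 : σ (2 * D + 2) = [] := h.even_eq_nil (r := D + 1) (by omega)
    have hod : σ (2 * D + 1) = [] := h.odd D le_rfl
    have hrep0 : Rep x (env ++ [0]) σ := by
      have := h.append (by omega) (l := []) (a := 0) rfl
      have hup : Function.update σ (2 * D) [] = σ := by rw [← hev, Function.update_eq_self]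
      rwa [← hD, hup] at this
    have hB0 : ∀ a ∈ env ++ [0], a ≤ B := by
      intro a ha
      rcases List.mem_append.1 ha with ha | ha
      · exact hB a ha
      · simp at ha; omega
    obtain ⟨he1, he2⟩ := ihe (o := D) hrep0 (by simp [hD]) hB0
    set w := denote x e (env ++ [0]) with hw
    rw [hod, List.append_nil, List.length_append, List.length_singleton, ← hD] at he2
    have hrep1 : Rep x (env ++ [w.length]) (Function.update σ (2 * D) (w.map Fin.val)) :=
      h.append (by omega) (by simp)
    have hB1 : ∀ a ∈ env ++ [w.length], a ≤ B + (cost e).eval B := by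
      intro a ha
      rcases List.mem_append.1 ha with ha | ha
      · have := hB a ha; omega
      · simp at ha; omega
    obtain ⟨hf1, hf2⟩ := ihf (o := o) hrep1 (by simp; omega) hB1
    rw [List.length_append, List.length_singleton, ← hD] at hf2
    have hc1 := Run.copy (σ := Function.update σ (2 * D + 1) (w.map Fin.val)) (r := 2 * D + 1)
      (d := 2 * D) (T := (cost e).eval B) (by simpa using he1)
    have hc2 := Run.copy (σ := Function.update (Function.update σ (2 * D + 1) (w.map Fin.val)) (2 * D)
      (w.map Fin.val)) (r := 2 * D + 2) (d := 2 * D + 1) (T := 0) (by simp [hev2])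
    have hs2 : Function.update (Function.update (Function.update σ (2 * D + 1) (w.map Fin.val)) (2 * D)
        (w.map Fin.val)) (2 * D + 1) [] = Function.update σ (2 * D) (w.map Fin.val) := by
      funext q
      by_cases hq : q = 2 * D + 1
      · subst hq; simp [hod]
      · simp [hq, Function.update_apply]
    simp only [Function.update_self] at hc1
    simp [hev2] at hc2
    rw [hs2] at hc2
    set y := denote x f (env ++ [w.length]) with hy
    have e2 : 2 * o + 1 ≠ 2 * D := by omega
    have e3 : 2 * D + 1 ≠ 2 * o + 1 := by omega
    rw [Function.update_of_ne e2] at hf2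
    have hc3 := Run.copy (σ := Function.update (Function.update σ (2 * D) (w.map Fin.val)) (2 * o + 1)
      (y.map Fin.val ++ σ (2 * o + 1))) (r := 2 * D + 1) (d := 2 * D) (T := 0)
      (by simp [Function.update_of_ne e3, hod])
    have hs3 : Function.update (Function.update (Function.update σ (2 * D) (w.map Fin.val)) (2 * o + 1)
        (y.map Fin.val ++ σ (2 * o + 1))) (2 * D)
        (Function.update (Function.update σ (2 * D) (w.map Fin.val)) (2 * o + 1)
        (y.map Fin.val ++ σ (2 * o + 1)) (2 * D + 1)) =
        Function.update σ (2 * o + 1) (y.map Fin.val ++ σ (2 * o + 1)) := by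
      funext q
      by_cases hq : q = 2 * D
      · subst hq; simp [Function.update_of_ne e3, hod, hev, e2.symm]
      · simp [hq, Function.update_apply]
    rw [hs3] at hc3
    refine ⟨?_, ?_⟩
    · simp only [denote, cost, eval_add, eval_comp, eval_X, eval_one]
      rw [← hw, ← hy]
      omega
    · simp only [denote, compile, cost, eval_add, eval_comp, eval_X, eval_one]
      rw [← hw, ← hy]
      refine he2.seq (hc1.seq (Run.seq (hc2.mono (by omega)) (hf2.seq (hc3.mono (by omega)))))
  | lt i r e f ihe ihf =>
    intro env σ o B h ho hB
    obtain ⟨he1, he2⟩ := ihe h ho hB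
    obtain ⟨hf1, hf2⟩ := ihf h ho hB
    have hr := h.len r
    refine ⟨?_, ?_⟩
    · simp only [denote, cost, eval_add, eval_mul, eval_X, eval_one]
      split_ifs <;> omega
    · have hd := h.run_dropProg hB i r
      simp only [denote, compile, cost, eval_add, eval_mul, eval_X, eval_one, eval_ofNat]
      refine hd.seq (Run.ite ?_)
      rw [Function.update_self, List.head?_drop]
      by_cases hlt : env.getD i 0 < env.getD r 0
      · rw [if_neg (by simp only [List.getElem?_eq_none_iff]; omega), if_pos hlt]
        exact (h.run_branch he2).mono (by omega)
      · rw [if_pos (by simp only [List.getElem?_eq_none_iff]; omega), if_neg hlt]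
        exact (h.run_branch hf2).mono (by omega)
  | bit i e f ihe ihf =>
    intro env σ o B h ho hB
    obtain ⟨he1, he2⟩ := ihe h ho hB
    obtain ⟨hf1, hf2⟩ := ihf h ho hB
    refine ⟨?_, ?_⟩
    · simp only [denote, cost, eval_add, eval_mul, eval_X, eval_one]
      split_ifs <;> omega
    · have hd := h.run_dropProg hB i 0
      simp only [denote, compile, cost, eval_add, eval_mul, eval_X, eval_one, eval_ofNat]
      refine hd.seq (Run.ite ?_)
      have hiff : (x.map Fin.val)[env.getD i 0]? = some 1 ↔ x[env.getD i 0]? = some 1 := by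
        rw [List.getElem?_map]
        cases x[env.getD i 0]? with
        | none => simp
        | some b => simp [Fin.ext_iff]
      rw [Function.update_self, List.head?_drop, mul_zero, h.input]
      by_cases hb : x[env.getD i 0]? = some 1
      · rw [if_pos (hiff.2 hb), if_pos hb]
        exact (h.run_branch he2).mono (by omega)
      · rw [if_neg (mt hiff.1 hb), if_neg hb]
        exact (h.run_branch hf2).mono (by omega)

end Emitter

theorem exists_eval_le_pow (p : ℕ[X]) : ∃ c, ∀ B, p.eval B ≤ (B + 2) ^ c := by
  induction p using Polynomial.induction_on' with
  | add p q hp hq =>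
    obtain ⟨c, hc⟩ := hp
    obtain ⟨d, hd⟩ := hq
    refine ⟨max c d + 1, fun B => ?_⟩
    have h1 : (B + 2) ^ c ≤ (B + 2) ^ max c d := Nat.pow_le_pow_right (by omega) (le_max_left _ _)
    have h2 : (B + 2) ^ d ≤ (B + 2) ^ max c d := Nat.pow_le_pow_right (by omega) (le_max_right _ _)
    have h3 : (B + 2) ^ max c d * 2 ≤ (B + 2) ^ max c d * (B + 2) :=
      Nat.mul_le_mul_left _ (by omega)
    have := hc B
    have := hd B
    rw [eval_add, pow_succ]
    omega
  | monomial n a =>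
    refine ⟨a + n, fun B => ?_⟩
    rw [eval_monomial, pow_add]
    refine Nat.mul_le_mul ?_ (Nat.pow_le_pow_left (by omega) n)
    exact Nat.lt_two_pow_self.le.trans (Nat.pow_le_pow_left (by omega) a)

/-- A map given by two emitters, one for the output string and one whose length is the output
parameter, can be computed in FPT time. The latter is evaluated under a binder, with level `2`
reserved. -/
theorem computableInFPTTime_denote (e f : Emitter) :
    ComputableInFPTTime fun I : List (Fin 2) × ℕ =>
      (e.denote I.1 [I.1.length, I.2], (f.denote I.1 [I.1.length, I.2, 0]).length) := by
  -- The parameter is re-emitted as a string of ones, whatever symbols `f` produces.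
  let f' : Emitter := .len f (.loop 2 (.sym 1))
  obtain ⟨c, hc⟩ := exists_eval_le_pow (e.cost + e.cost + f'.cost + f'.cost + X + 7)
  refine ⟨.seq (.copy 1 2) (.seq (.copy 3 1) (.seq (f'.compile 2 1) (.seq (e.compile 2 0)
    (.seq (.copy 1 0) (.seq (.copy 3 1) (.seq (.copy 4 2) (.copy 4 3))))))),
    fun k => (k + 2) ^ c, c, computable_pow (computable_add Computable.id (Computable.const 2)) c,
    fun x k => ?_⟩
  set env := [x.length, k] with henv
  let σ : Store := fun r => if r = 0 then x.map Fin.val else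
    if r = 2 then List.replicate k 1 else []
  have hrep : Emitter.Rep x env σ := by
    refine ⟨by simp [σ], fun r => ?_, fun r hr => ?_⟩
    · match r with
      | 0 => simp [σ, henv]
      | 1 => simp [σ, henv]
      | r + 2 =>
        have h1 : 2 * (r + 2) ≠ 0 := by omega
        have h2 : 2 * (r + 2) ≠ 2 := by omega
        simp [σ, henv]
    · have h1 : 2 * r + 1 ≠ 2 := by omega
      simp [σ, h1]
  have hB : ∀ a ∈ env, a ≤ x.length + k := by
    intro a ha
    simp [henv] at ha
    omega
  obtain ⟨hf1, hf2⟩ := f'.run_compile (o := 1) hrep (by simp [henv]) hB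
  have hrep' := hrep.update_odd (o := 1) (by simp [henv])
    ((f'.denote x env).map Fin.val ++ σ (2 * 1 + 1))
  obtain ⟨he1, he2⟩ := e.run_compile (o := 0) hrep' (by simp [henv]) hB
  set B := x.length + k with hBdef
  set y := e.denote x env
  have hy' : f'.denote x env = List.replicate (f.denote x [x.length, k, 0]).length 1 := by
    simp [f', Emitter.denote, henv, List.eq_replicate_iff]
  set m := (f.denote x [x.length, k, 0]).length
  rw [hy'] at hf1 hf2 he2
  rw [List.length_replicate] at hf1
  have hl : env.length = 2 := rfl
  rw [hl] at hf2 he2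
  -- The parameter moves from register 1 to register 2, the place of the variable `1`.
  have r1 := Run.copy (σ := ioStore (x, k)) (r := 1) (d := 2) (T := B) (by simp [ioStore]; omega)
  have r2 := Run.copy (σ := Function.update (ioStore (x, k)) 2 (ioStore (x, k) 1)) (r := 3) (d := 1)
    (T := 0) (by simp [ioStore])
  have s2 : Function.update (Function.update (ioStore (x, k)) 2 (ioStore (x, k) 1)) 1
      (Function.update (ioStore (x, k)) 2 (ioStore (x, k) 1) 3) = σ := by
    funext q
    by_cases h1 : q = 1
    · subst h1; simp [ioStore, σ]
    · by_cases h2 : q = 2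
      · subst h2; simp [ioStore, σ]
      · simp [ioStore, σ, h1, h2]
  rw [s2] at r2
  let τ : Store := fun r => if r = 0 then x.map Fin.val else if r = 1 then y.map Fin.val else
    if r = 2 then List.replicate k 1 else if r = 3 then List.replicate m 1 else []
  have s4 : Function.update (Function.update σ (2 * 1 + 1)
      ((List.replicate m 1 : List (Fin 2)).map Fin.val ++ σ (2 * 1 + 1))) (2 * 0 + 1)
      (y.map Fin.val ++ Function.update σ (2 * 1 + 1)
      ((List.replicate m 1 : List (Fin 2)).map Fin.val ++ σ (2 * 1 + 1)) (2 * 0 + 1)) = τ := by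
    funext q
    by_cases h1 : q = 1
    · subst h1; simp [σ, τ]
    · by_cases h3 : q = 3
      · subst h3; simp [σ, τ]
      · simp [σ, τ, h1, h3]
  rw [s4] at he2
  -- The two results move from the registers 1 and 3 to their places, and the rest is cleared.
  have r5 := Run.copy (σ := τ) (r := 1) (d := 0) (T := e.cost.eval B) (by simpa [τ] using he1)
  have r6 := Run.copy (σ := Function.update τ 0 (τ 1)) (r := 3) (d := 1) (T := f'.cost.eval B)
    (by simpa [τ] using hf1)
  have r7 := Run.copy (σ := Function.update (Function.update τ 0 (τ 1)) 1
    (Function.update τ 0 (τ 1) 3)) (r := 4) (d := 2) (T := 0) (by simp [τ])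
  have r8 := Run.copy (σ := Function.update (Function.update (Function.update τ 0 (τ 1)) 1
    (Function.update τ 0 (τ 1) 3)) 2 (Function.update (Function.update τ 0 (τ 1)) 1
    (Function.update τ 0 (τ 1) 3) 4)) (r := 4) (d := 3) (T := 0) (by simp [τ])
  have s8 : Function.update (Function.update (Function.update (Function.update τ 0 (τ 1)) 1
      (Function.update τ 0 (τ 1) 3)) 2 (Function.update (Function.update τ 0 (τ 1)) 1
      (Function.update τ 0 (τ 1) 3) 4)) 3 (Function.update (Function.update
      (Function.update τ 0 (τ 1)) 1 (Function.update τ 0 (τ 1) 3)) 2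
      (Function.update (Function.update τ 0 (τ 1)) 1 (Function.update τ 0 (τ 1) 3) 4) 4) =
      ioStore (y, m) := by
    funext q
    match q with
    | 0 => simp [τ, ioStore]
    | 1 => simp [τ, ioStore]
    | 2 => simp [τ, ioStore]
    | 3 => simp [τ, ioStore]
    | q + 4 => simp [τ, ioStore]
  rw [s8] at r8
  obtain ⟨t, ht, hexec⟩ :=
    r1.seq (r2.seq (hf2.seq (he2.seq (r5.seq (r6.seq (r7.seq r8))))))
  refine ⟨t, ht.trans ?_, hexec⟩
  calc _ ≤ (e.cost + e.cost + f'.cost + f'.cost + X + 7).eval B := by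
        simp only [eval_add, eval_X, eval_ofNat]
        omega
    _ ≤ (B + 2) ^ c := hc B
    _ ≤ ((k + 2) * (x.length + 1)) ^ c := by
        refine Nat.pow_le_pow_left ?_ c
        simp only [hBdef]
        nlinarith [Nat.zero_le (k * x.length)]
    _ = _ := mul_pow _ _ _

/-! ### Gadgets from failing polymorphisms -/

/-- A constraint scheme over `Γ` with four slots: the `i`-th argument of the relation reads the
value `p ∈ {0, 1, 2}` of slot `slot i` through the monotone map `val i`. -/
structure Template (Γ : Language) where
  rel : Fin Γ.length
  slot : Fin (Γ.get rel).arity → Fin 4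
  val : Fin (Γ.get rel).arity → Fin 3 → Fin (Γ.get rel).dom
  mono : ∀ i, Monotone (val i)

namespace Template

variable {Γ : Language}

/-- The scheme is satisfied when its slots have the values `p`. -/
def Holds (t : Template Γ) (p : Fin 4 → Fin 3) : Prop :=
  (fun i => t.val i (p (t.slot i))) ∈ (Γ.get t.rel).tuples

/-- The scheme with its slots renamed. -/
def rename (t : Template Γ) (π : Fin 4 → Fin 4) : Template Γ :=
  ⟨t.rel, π ∘ t.slot, t.val, t.mono⟩

theorem holds_rename (t : Template Γ) (π : Fin 4 → Fin 4) (p : Fin 4 → Fin 3) :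
    (t.rename π).Holds p ↔ t.Holds (p ∘ π) := Iff.rfl

end Template

/-- The common form of `minPattern` (`c = 0`) and `maxPattern` (`c = 1`). -/
def latticePattern (c : Fin 2) : MultiOp (Fin 2) 2 :=
  fun x => {y | (x = ![0, 1] ∨ x = ![1, 0]) ∧ y = c}

/-- If two tuples `t₀, t₁ ∈ R` are mapped to `z ∉ R`, then each coordinate takes two values, the
smaller one either in `t₀` (slot `0`) or in `t₁` (slot `1`). -/
theorem exists_template_of_not_latticePattern {Γ : Language} {c : Fin 2}
    (h : ¬ FamilyPreserves Mo (latticePattern c) Γ) :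
    ∃ t : Template Γ, ∀ p, (p 0 = 0 → p 1 = 2 → t.Holds p) ∧ (p 0 = 2 → p 1 = 0 → t.Holds p) ∧
      (p 0 = ![0, 2] c → p 1 = ![0, 2] c → ¬ t.Holds p) := by
  simp only [FamilyPreserves, Preserves, not_forall] at h
  obtain ⟨R, hR, t, ht, z, hz, hzR⟩ := h
  obtain ⟨ρ, rfl⟩ := List.mem_iff_get.1 hR
  choose m hm x hx w hw hwz using hz
  -- Only the values `0` and `2` of the slots matter here; they play the roles of `0, 1 ∈ [2]`.
  let s : Fin 3 → Fin 2 := ![0, 0, 1]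
  have hs : Monotone s := by decide
  let T : Template Γ := ⟨ρ, fun i => if x i = ![0, 1] then 0 else 1, fun i => m i ∘ s,
    fun i => (hm i).comp hs⟩
  have key : ∀ p, T.Holds p ↔
      (fun i => m i (s (p (if x i = ![0, 1] then 0 else 1)))) ∈ (Γ.get ρ).tuples := fun p => Iff.rfl
  refine ⟨T, fun p => ⟨fun h0 h1 => ?_, fun h0 h1 => ?_, fun h0 h1 hp => hzR ?_⟩⟩
  · rw [key]
    convert ht 0 using 1
    funext i
    have := congr_fun (hx i) 0
    rcases (hw i).1 with hi | hi
    · simpa [hi, h0, h1, s] using this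
    · simpa [hi, h0, h1, s] using this
  · rw [key]
    convert ht 1 using 1
    funext i
    have := congr_fun (hx i) 1
    rcases (hw i).1 with hi | hi
    · simpa [hi, h0, h1, s] using this
    · simpa [hi, h0, h1, s] using this
  · rw [key] at hp
    convert hp using 1
    funext i
    rw [← hwz i, (hw i).2]
    have hc : s (![0, 2] c) = c := by fin_cases c <;> rfl
    rcases (hw i).1 with hi | hi
    · simp [hi, h0, hc]
    · simp [hi, h1, hc]

/-- Together the failures of `min` and `max` define the relation `≠` on `{0, 2}`. -/
theorem exists_xorTemplates {Γ : Language} (h : DomainReversible Γ) :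
    ∃ ts : List (Template Γ), ∀ p, p 0 ≠ 1 → p 1 ≠ 1 →
      ((∀ t ∈ ts, t.Holds p) ↔ p 0 ≠ p 1) := by
  obtain ⟨t, ht⟩ := exists_template_of_not_latticePattern (c := 0) h.1
  obtain ⟨t', ht'⟩ := exists_template_of_not_latticePattern (c := 1) h.2
  refine ⟨[t, t'], fun p h0 h1 => ?_⟩
  obtain ⟨a1, a2, a3⟩ := ht p
  obtain ⟨b1, b2, b3⟩ := ht' p
  have h3 : ∀ a : Fin 3, a ≠ 1 → a = 0 ∨ a = 2 := by decide
  have e0 := h3 _ h0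
  have e1 := h3 _ h1
  rcases e0 with e0 | e0 <;> rcases e1 with e1 | e1 <;> simp_all

/-- The values of the four slots when the slots `1` and `3` hold the reversals of the slots `0` and
`2`. -/
def slots (a b : Fin 3) : Fin 4 → Fin 3 := ![a, a.rev, b, b.rev]

/-- A failure of the connector pattern defines a relation `T ⊆ {0, 1, 2}²` that contains the four
corners and the centre but not `(0, 1)`. The coordinates of the two cases of the pattern read the
slots `0, 1` and `2, 3`, antitone maps being monotone maps of the reversed slot. -/
theorem exists_template_of_not_connectorProperty {Γ : Language} (h : ¬ ConnectorProperty Γ) :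
    ∃ t : Template Γ, t.Holds (slots 0 0) ∧ t.Holds (slots 0 2) ∧ t.Holds (slots 1 1) ∧
      t.Holds (slots 2 0) ∧ t.Holds (slots 2 2) ∧ ¬ t.Holds (slots 0 1) := by
  classical
  simp only [ConnectorProperty, FamilyPreserves, Preserves, not_forall] at h
  obtain ⟨R, hR, t, ht, z, hz, hzR⟩ := h
  obtain ⟨ρ, rfl⟩ := List.mem_iff_get.1 hR
  choose m hm x hx w hw hwz using hz
  let T : Template Γ := ⟨ρ,
    fun i => if x i = ![0, 0, 1, 2, 2] then (if Monotone (m i) then 0 else 1)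
      else (if Monotone (m i) then 2 else 3),
    fun i => if Monotone (m i) then m i else m i ∘ Fin.rev, fun i => by
      split_ifs with hi
      · exact hi
      · exact ((hm i).resolve_left hi : Antitone (m i)).comp Fin.rev_anti⟩
  have key : ∀ a b, T.Holds (slots a b) ↔
      (fun i => m i (if x i = ![0, 0, 1, 2, 2] then a else b)) ∈ (Γ.get ρ).tuples := by
    intro a b
    have : (fun i => T.val i (slots a b (T.slot i))) =
        fun i => m i (if x i = ![0, 0, 1, 2, 2] then a else b) := by
      funext i
      by_cases h1 : Monotone (m i) <;> by_cases h2 : x i = ![0, 0, 1, 2, 2] <;>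
        simp [T, h1, h2, slots]
    unfold Template.Holds
    rw [this]
  have hB : ∀ i, (x i = ![0, 0, 1, 2, 2] ∧ w i = 0) ∨
      (x i ≠ ![0, 0, 1, 2, 2] ∧ x i = ![0, 2, 1, 0, 2] ∧ w i = 1) := by
    intro i
    rcases hw i with h1 | h1
    · exact .inl h1
    · exact .inr ⟨by rw [h1.1]; decide, h1⟩
  have hpos : ∀ (a b : Fin 3) (j : Fin 5), ![0, 0, 1, 2, 2] j = a → ![0, 2, 1, 0, 2] j = b →
      T.Holds (slots a b) := by
    intro a b j ha hb
    rw [key]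
    convert ht j using 1
    funext i
    rw [← congr_fun (hx i) j]
    rcases hB i with h1 | h1
    · rw [if_pos h1.1, h1.1, ha]
    · rw [if_neg h1.1, h1.2.1, hb]
  refine ⟨T, hpos 0 0 0 rfl rfl, hpos 0 2 1 rfl rfl, hpos 1 1 2 rfl rfl, hpos 2 0 3 rfl rfl,
    hpos 2 2 4 rfl rfl, fun hT => hzR ?_⟩
  rw [key] at hT
  convert hT using 1
  funext i
  rw [← hwz i]
  rcases hB i with h1 | h1
  · rw [if_pos h1.1, h1.2]
  · rw [if_neg h1.1, h1.2.2]

/-- Conjoining the relation `T` with its images under reversing either argument and under swapping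
the arguments leaves exactly the pairs with both or no entry equal to `1`. -/
theorem exists_iffTemplates {Γ : Language} (h : ¬ ConnectorProperty Γ) :
    ∃ ts : List (Template Γ), ∀ a b, (∀ t ∈ ts, t.Holds (slots a b)) ↔ (a = 1 ↔ b = 1) := by
  obtain ⟨t, h00, h02, h11, h20, h22, h01⟩ := exists_template_of_not_connectorProperty h
  refine ⟨[t, t.rename ![1, 0, 2, 3], t.rename ![0, 1, 3, 2], t.rename ![1, 0, 3, 2],
    t.rename ![2, 3, 0, 1], t.rename ![3, 2, 0, 1], t.rename ![2, 3, 1, 0],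
    t.rename ![3, 2, 1, 0]], fun a b => ?_⟩
  have e1 : slots a b ∘ ![1, 0, 2, 3] = slots a.rev b := by
    funext i; fin_cases i <;> simp [slots]
  have e2 : slots a b ∘ ![0, 1, 3, 2] = slots a b.rev := by
    funext i; fin_cases i <;> simp [slots]
  have e3 : slots a b ∘ ![1, 0, 3, 2] = slots a.rev b.rev := by
    funext i; fin_cases i <;> simp [slots]
  have e4 : slots a b ∘ ![2, 3, 0, 1] = slots b a := by
    funext i; fin_cases i <;> simp [slots]
  have e5 : slots a b ∘ ![3, 2, 0, 1] = slots b.rev a := by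
    funext i; fin_cases i <;> simp [slots]
  have e6 : slots a b ∘ ![2, 3, 1, 0] = slots b a.rev := by
    funext i; fin_cases i <;> simp [slots]
  have e7 : slots a b ∘ ![3, 2, 1, 0] = slots b.rev a.rev := by
    funext i; fin_cases i <;> simp [slots]
  simp only [List.forall_mem_cons, Template.holds_rename, e1, e2, e3, e4, e5, e6, e7]
  have r0 : Fin.rev (0 : Fin 3) = 2 := rfl
  have r1 : Fin.rev (1 : Fin 3) = 1 := rfl
  have r2 : Fin.rev (2 : Fin 3) = 0 := rfl
  have h3 : ∀ a : Fin 3, a = 0 ∨ a = 1 ∨ a = 2 := by decide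
  have ha := h3 a
  have hb := h3 b
  rcases ha with rfl | rfl | rfl <;> rcases hb with rfl | rfl | rfl <;> simp_all

/-! ### Strings that encode graphs -/

theorem flatMap_range_succ {α : Type*} (n : ℕ) (g : ℕ → List α) :
    (List.range (n + 1)).flatMap g = (List.range n).flatMap g ++ g n := by
  simp [List.range_succ]

theorem filter_lt_range {m n : ℕ} (h : m ≤ n) : (List.range n).filter (· < m) = List.range m := by
  induction n, h using Nat.le_induction with
  | base => rw [List.filter_eq_self]; simp
  | succ n hn ih => rw [List.range_succ, List.filter_append, ih]; simp; omega

/-- The number of entries in the first `v` rows of a strict lower triangle. -/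
def tri (v : ℕ) : ℕ := ((List.range v).map id).sum

theorem tri_succ (v : ℕ) : tri (v + 1) = tri v + v := by simp [tri, List.range_succ]

theorem tri_add_lt {u v n : ℕ} (hu : u < v) (hv : v < n) : tri v + u < tri n := by
  induction n, hv using Nat.le_induction with
  | base => rw [tri_succ]; omega
  | succ n hn ih => rw [tri_succ]; omega

/-- The strict lower triangle of the matrix `f`, row by row. -/
def triangle (f : ℕ → ℕ → Fin 2) (n : ℕ) : List (Fin 2) :=
  (List.range n).flatMap fun v => (List.range v).map (f v)

theorem triangle_succ (f : ℕ → ℕ → Fin 2) (n : ℕ) :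
    triangle f (n + 1) = triangle f n ++ (List.range n).map (f n) := flatMap_range_succ _ _

theorem length_triangle (f : ℕ → ℕ → Fin 2) (n : ℕ) : (triangle f n).length = tri n := by
  induction n with
  | zero => rfl
  | succ n ih => rw [triangle_succ, tri_succ]; simp [ih]

theorem triangle_congr {f g : ℕ → ℕ → Fin 2} {n : ℕ} (h : ∀ v < n, ∀ u < v, f v u = g v u) :
    triangle f n = triangle g n := by
  induction n with
  | zero => rfl
  | succ n ih =>
    rw [triangle_succ, triangle_succ, ih fun v hv => h v (by omega)]
    congr 1
    exact List.map_congr_left fun u hu => h n (by omega) u (List.mem_range.1 hu)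

theorem getElem?_triangle (f : ℕ → ℕ → Fin 2) {u v n : ℕ} (hu : u < v) (hv : v < n) :
    (triangle f n)[tri v + u]? = some (f v u) := by
  induction n, hv using Nat.le_induction with
  | base =>
    rw [triangle_succ, List.getElem?_append_right (by rw [length_triangle]; omega),
      length_triangle]
    simp [hu]
  | succ n hn ih =>
    rw [triangle_succ, List.getElem?_append_left, ih]
    rw [length_triangle]
    exact tri_add_lt hu hn

theorem triangle_getElem? {l : List (Fin 2)} {n : ℕ} (hl : l.length = tri n) :
    triangle (fun v u => l[tri v + u]?.getD 0) n = l := by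
  induction n generalizing l with
  | zero => exact (List.length_eq_zero_iff.1 hl).symm
  | succ n ih =>
    rw [tri_succ] at hl
    have htake : (l.take (tri n)).length = tri n := by simp [hl]
    rw [triangle_succ]
    conv_rhs => rw [← List.take_append_drop (tri n) l]
    congr 1
    · conv_rhs => rw [← ih htake]
      refine triangle_congr fun v hv u hu => ?_
      rw [List.getElem?_take_of_lt (tri_add_lt hu hv)]
    · refine List.ext_getElem (by simp [hl]) fun i h1 h2 => ?_
      simp at h1 h2
      have : tri n + i < l.length := by omega
      simp [this]

theorem encodeGraph_eq {n : ℕ} (G : SimpleGraph (Fin n)) (f : ℕ → ℕ → Fin 2)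
    (hf : ∀ u v : Fin n, u < v → (f v u = 1 ↔ G.Adj u v)) :
    encodeGraph G = unary n ++ triangle f n := by
  classical
  have h2 : ∀ b : Fin 2, b = 1 ∨ b = 0 := by decide
  have hrow : ∀ v : Fin n, ((List.finRange n).filter (· < v)).map
      (fun u => if G.Adj u v then (1 : Fin 2) else 0) = (List.range v).map (f v) := by
    intro v
    have h1 : ((List.finRange n).filter (· < v)).map Fin.val = List.range v := by
      rw [← filter_lt_range v.2.le, ← List.map_coe_finRange_eq_range, List.filter_map]
      rfl
    rw [← h1, List.map_map]
    refine List.map_congr_left fun u hu => ?_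
    simp only [List.mem_filter, decide_eq_true_eq] at hu
    rw [Function.comp_apply]
    have h3 := hf u v hu.2
    rcases h2 (f v u) with h | h
    · rw [if_pos (h3.1 h), h]
    · rw [if_neg fun h' => by simp [h3.2 h'] at h, h]
  unfold encodeGraph triangle
  rw [← List.map_coe_finRange_eq_range, List.flatMap_map]
  congr 1
  congr 1
  funext v
  exact (hrow v)

/-- The string `x` encodes some graph on `n` vertices. -/
structure IsGraphCode (x : List (Fin 2)) (n : ℕ) : Prop where
  length_eq : x.length = n + 1 + tri n
  ones : ∀ t < n, x[t]? = some 1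
  zero : x[n]? ≠ some 1

theorem IsGraphCode.unique {x : List (Fin 2)} {m n : ℕ} (hm : IsGraphCode x m)
    (hn : IsGraphCode x n) : m = n := by
  rcases lt_trichotomy m n with h | h | h
  · exact absurd (hn.ones m h) hm.zero
  · exact h
  · exact absurd (hm.ones n h) hn.zero

theorem length_unary (m : ℕ) : (unary m).length = m + 1 := by simp [unary]

theorem isGraphCode_encodeGraph {n : ℕ} (G : SimpleGraph (Fin n)) :
    IsGraphCode (encodeGraph G) n ∧ ∀ u v : Fin n, u < v →
      ((encodeGraph G)[n + 1 + tri v + u]? = some 1 ↔ G.Adj u v) := by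
  classical
  let f : ℕ → ℕ → Fin 2 := fun v u => if ∃ (hv : v < n) (hu : u < n), G.Adj ⟨u, hu⟩ ⟨v, hv⟩
    then 1 else 0
  have hf : ∀ u v : Fin n, u < v → (f v u = 1 ↔ G.Adj u v) := by
    intro u v _
    simp [f]
  have hG := encodeGraph_eq G f hf
  rw [hG]
  refine ⟨⟨?_, fun t ht => ?_, ?_⟩, fun u v huv => ?_⟩
  · rw [List.length_append, length_unary, length_triangle]
  · rw [List.getElem?_append_left (by rw [length_unary]; omega), unary,
      List.getElem?_append_left (by simpa using ht)]
    simp [ht]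
  · rw [List.getElem?_append_left (by rw [length_unary]; omega), unary,
      List.getElem?_append_right (by simp)]
    simp
  · rw [List.getElem?_append_right (by rw [length_unary]; omega), length_unary,
      show n + 1 + tri v + u - (n + 1) = tri v + u by omega, getElem?_triangle f huv v.2, ← hf u v huv]
    simp

theorem IsGraphCode.exists_graph {x : List (Fin 2)} {n : ℕ} (h : IsGraphCode x n) :
    ∃ G : SimpleGraph (Fin n), x = encodeGraph G := by
  classical
  let l := x.drop (n + 1)
  let f : ℕ → ℕ → Fin 2 := fun v u => l[tri v + u]?.getD 0
  let G : SimpleGraph (Fin n) := SimpleGraph.fromRel fun u v => u < v ∧ f v u = 1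
  have hf : ∀ u v : Fin n, u < v → (f v u = 1 ↔ G.Adj u v) := by
    intro u v huv
    simp only [G, SimpleGraph.fromRel_adj]
    constructor
    · exact fun h => ⟨huv.ne, .inl ⟨huv, h⟩⟩
    · rintro ⟨-, h | h⟩
      · exact h.2
      · exact absurd h.1 huv.not_gt
  refine ⟨G, ?_⟩
  have hlen := h.length_eq
  rw [encodeGraph_eq G f hf, triangle_getElem? (by simp [l, hlen])]
  conv_lhs => rw [← List.take_append_drop (n + 1) x]
  congr 1
  refine List.ext_getElem (by rw [length_unary]; simp; omega) fun i h1 h2 => ?_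
  rw [length_unary] at h2
  have hi : i < x.length := by omega
  rw [List.getElem_take]
  by_cases hin : i < n
  · have := h.ones i hin
    rw [List.getElem?_eq_getElem hi] at this
    simp only [unary]
    rw [List.getElem_append_left (by simpa using hin)]
    simpa using this
  · obtain rfl : i = n := by omega
    have := h.zero
    rw [List.getElem?_eq_getElem hi] at this
    have h2 : ∀ b : Fin 2, some b ≠ some 1 → b = 0 := by decide
    rw [h2 _ this]
    simp [unary]

/-! ### Instances are determined by their encodings -/

theorem unary_append_inj {m m' : ℕ} {l l' : List (Fin 2)} (h : unary m ++ l = unary m' ++ l') :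
    m = m' ∧ l = l' := by
  induction m generalizing m' with
  | zero =>
    cases m' with
    | zero => simpa [unary] using h
    | succ m' => simp [unary, List.replicate_succ] at h
  | succ m ih =>
    cases m' with
    | zero => simp [unary, List.replicate_succ] at h
    | succ m' =>
      have : unary m ++ l = unary m' ++ l' := by
        simpa [unary, List.replicate_succ] using h
      simpa using ih this

theorem flatMap_append_inj {ι : Type*} {g g' : ι → List (Fin 2)} {P : ι → Prop} (L : List ι)
    (hg : ∀ i l l', g i ++ l = g' i ++ l' → P i ∧ l = l') {l l' : List (Fin 2)}
    (h : L.flatMap g ++ l = L.flatMap g' ++ l') : (∀ i ∈ L, P i) ∧ l = l' := by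
  induction L with
  | nil => simpa using h
  | cons i L ih =>
    simp only [List.flatMap_cons, List.append_assoc] at h
    obtain ⟨h1, h2⟩ := hg i _ _ h
    obtain ⟨h3, h4⟩ := ih h2
    exact ⟨by simpa using ⟨h1, h3⟩, h4⟩

theorem GuardedConstraint.encode_append_inj {Γ : Language} {M : MapFamily} {n k : ℕ}
    {c c' : GuardedConstraint Γ M n k} {l l' : List (Fin 2)}
    (h : c.encode ++ l = c'.encode ++ l') : c = c' ∧ l = l' := by
  obtain ⟨ρ, v, m, hm⟩ := c
  obtain ⟨ρ', v', m', hm'⟩ := c'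
  simp only [GuardedConstraint.encode, List.append_assoc] at h
  obtain ⟨h1, h2⟩ := unary_append_inj h
  obtain rfl := Fin.ext h1
  have h3 := flatMap_append_inj (P := fun i => v i = v' i ∧ m i = m' i) _ (fun i l l' h => by
    simp only [List.append_assoc] at h
    obtain ⟨h5, h6⟩ := unary_append_inj h
    obtain ⟨h7, h8⟩ := flatMap_append_inj (P := fun a => m i a = m' i a) _
      (fun a l l' h => ⟨Fin.ext (unary_append_inj h).1, (unary_append_inj h).2⟩) h6
    exact ⟨⟨Fin.ext h5, funext fun a => h7 a (List.mem_finRange a)⟩, h8⟩) h2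
  refine ⟨?_, h3.2⟩
  obtain rfl : v = v' := funext fun i => (h3.1 i (List.mem_finRange i)).1
  obtain rfl : m = m' := funext fun i => (h3.1 i (List.mem_finRange i)).2
  rfl

theorem GuardedConstraint.encode_ne_nil {Γ : Language} {M : MapFamily} {n k : ℕ}
    (c : GuardedConstraint Γ M n k) : c.encode ≠ [] := by
  simp [GuardedConstraint.encode, unary]

theorem GuardedConstraint.flatMap_encode_inj {Γ : Language} {M : MapFamily} {n k : ℕ}
    {cs cs' : List (GuardedConstraint Γ M n k)} (h : cs.flatMap encode = cs'.flatMap encode) :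
    cs = cs' := by
  induction cs generalizing cs' with
  | nil =>
    cases cs' with
    | nil => rfl
    | cons c' cs' => simp [c'.encode_ne_nil] at h
  | cons c cs ih =>
    cases cs' with
    | nil => simp [c.encode_ne_nil] at h
    | cons c' cs' =>
      simp only [List.flatMap_cons] at h
      obtain ⟨rfl, h2⟩ := encode_append_inj h
      rw [ih h2]

theorem UdInstance.encode_injective {Γ : Language} {M : MapFamily} {I J : UdInstance Γ M}
    (h : I.encode = J.encode) : I = J := by
  obtain ⟨n, k, cs⟩ := I
  obtain ⟨n', k', cs'⟩ := J
  simp only [UdInstance.encode, List.append_assoc] at h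
  obtain ⟨rfl, h2⟩ := unary_append_inj h
  obtain ⟨rfl, h3⟩ := unary_append_inj h2
  rw [GuardedConstraint.flatMap_encode_inj h3]

/-! ### Encoded lists of constraints -/

/-- The string `l` is the encoding of a list of constraints, over `K` variables with domain
`{0, …, N - 1}`, whose set of solutions is `S`. -/
def Encodes (Γ : Language) (N K : ℕ) (l : List (Fin 2)) (S : (Fin K → Fin N) → Prop) : Prop :=
  ∃ cs : List (GuardedConstraint Γ Mo N K), l = cs.flatMap GuardedConstraint.encode ∧
    ∀ f, (∀ c ∈ cs, (fun i => c.maps i (f (c.vars i))) ∈ (Γ.get c.rel).tuples) ↔ S f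

namespace Encodes

variable {Γ : Language} {N K : ℕ} {l l' : List (Fin 2)} {S S' : (Fin K → Fin N) → Prop}

theorem congr (h : Encodes Γ N K l S) (hl : l' = l) (hS : ∀ f, S f ↔ S' f) :
    Encodes Γ N K l' S' := by
  obtain ⟨cs, rfl, hcs⟩ := h
  exact ⟨cs, hl, fun f => (hcs f).trans (hS f)⟩

theorem nil : Encodes Γ N K [] fun _ => True := ⟨[], rfl, by simp⟩

theorem append (h : Encodes Γ N K l S) (h' : Encodes Γ N K l' S') :
    Encodes Γ N K (l ++ l') fun f => S f ∧ S' f := by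
  obtain ⟨cs, rfl, hcs⟩ := h
  obtain ⟨cs', rfl, hcs'⟩ := h'
  refine ⟨cs ++ cs', by simp, fun f => ?_⟩
  rw [List.forall_mem_append, hcs, hcs']

theorem flatMap {ι : Type*} (L : List ι) {g : ι → List (Fin 2)}
    {S : ι → (Fin K → Fin N) → Prop} (h : ∀ i ∈ L, Encodes Γ N K (g i) (S i)) :
    Encodes Γ N K (L.flatMap g) fun f => ∀ i ∈ L, S i f := by
  induction L with
  | nil => exact nil.congr rfl (by simp)
  | cons i L ih =>
    refine ((h i (by simp)).append (ih fun j hj => h j (by simp [hj]))).congr (by simp) ?_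
    simp

theorem range {m : ℕ} {g : ℕ → List (Fin 2)} {S : ℕ → (Fin K → Fin N) → Prop}
    (h : ∀ i < m, Encodes Γ N K (g i) (S i)) :
    Encodes Γ N K ((List.range m).flatMap g) fun f => ∀ i < m, S i f :=
  (flatMap (List.range m) fun i hi => h i (List.mem_range.1 hi)).congr rfl (by simp)

theorem ite {p : Prop} [Decidable p] (h : p → Encodes Γ N K l S) (h' : ¬p → Encodes Γ N K l' S') :
    Encodes Γ N K (if p then l else l') fun f => (p → S f) ∧ (¬p → S' f) := by
  by_cases hp : p
  · exact (h hp).congr (by simp [hp]) (by simp [hp])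
  · exact (h' hp).congr (by simp [hp]) (by simp [hp])

theorem mem_monotoneCSP_iff (h : Encodes Γ N K l S) :
    (unary N ++ unary K ++ l, K) ∈ MonotoneCSP Γ ↔ ∃ f, S f := by
  obtain ⟨cs, rfl, hcs⟩ := h
  constructor
  · rintro ⟨J, hJ, f, hf⟩
    have h2 : (⟨N, K, cs⟩ : UdInstance Γ Mo) = J :=
      UdInstance.encode_injective (by simpa [UdInstance.encode] using congrArg Prod.fst hJ)
    subst h2
    exact ⟨f, (hcs f).1 hf⟩
  · rintro ⟨f, hf⟩
    exact ⟨⟨N, K, cs⟩, rfl, f, (hcs f).2 hf⟩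

end Encodes

/-! ### Template constraints -/

/-- The position of `a` relative to the interval `[lo, hi)`: `0` to the left, `1` inside, `2` to the
right. -/
def level (lo hi a : ℕ) : Fin 3 := if a < lo then 0 else if a < hi then 1 else 2

theorem monotone_level (lo hi : ℕ) : Monotone (level lo hi) := by
  intro a b hab
  unfold level
  split_ifs <;> omega

theorem level_eq_one {lo hi a : ℕ} : level lo hi a = 1 ↔ lo ≤ a ∧ a < hi := by
  unfold level
  split_ifs <;> simp <;> omega

theorem level_self (lo a : ℕ) : level lo lo a = if a < lo then 0 else 2 := by
  unfold level
  split_ifs <;> rfl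

theorem level_rev {lo hi N a b : ℕ} (h : lo ≤ hi) (hN : hi ≤ N) (hab : a + b + 1 = N) :
    level (N - hi) (N - lo) b = (level lo hi a).rev := by
  unfold level
  split_ifs <;> first | omega | rfl

/-- The value of the variable numbered `v` under the assignment `f`. -/
def value {N K : ℕ} (f : Fin K → Fin N) (v : ℕ) : ℕ := if h : v < K then f ⟨v, h⟩ else 0

theorem value_of_lt {N K : ℕ} (f : Fin K → Fin N) {v : ℕ} (h : v < K) :
    value f v = f ⟨v, h⟩ := dif_pos h

/-- The template constraint whose slot `s` is the variable `W s`, read through the position relative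
to the interval `[lo s, hi s)`. -/
theorem Template.encodes {Γ : Language} (t : Template Γ) {N K : ℕ} (W lo hi : Fin 4 → ℕ)
    (hW : ∀ s, W s < K) :
    Encodes Γ N K (unary t.rel ++ (List.finRange (Γ.get t.rel).arity).flatMap fun i =>
      unary (W (t.slot i)) ++ (List.range N).flatMap fun a =>
        unary (t.val i (level (lo (t.slot i)) (hi (t.slot i)) a)))
      fun f => t.Holds fun s => level (lo s) (hi s) (value f (W s)) := by
  refine ⟨[⟨t.rel, fun i => ⟨W (t.slot i), hW _⟩,
    fun i a => t.val i (level (lo (t.slot i)) (hi (t.slot i)) a),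
    fun i a b hab => t.mono i (monotone_level _ _ hab)⟩], ?_, fun f => ?_⟩
  · simp only [List.flatMap_cons, List.flatMap_nil, List.append_nil, GuardedConstraint.encode]
    simp only [← List.map_coe_finRange_eq_range, List.flatMap_map]
  · simp only [List.mem_singleton, forall_eq, Template.Holds, value_of_lt f (hW _)]

/-! ### Pairs of intervals and independent sets -/

/-- All templates `ts` hold for the variable `w` with the interval `[lo, hi)` (slots `0`, `1`) and
the variable `w'` with the interval `[lo', hi')` (slots `2`, `3`). The variable `q + v` plays the
role of the reversal of `v`; it is read relative to the reversed interval. -/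
def PairHolds {Γ : Language} (ts : List (Template Γ)) (N q : ℕ) (F : ℕ → ℕ)
    (w lo hi w' lo' hi' : ℕ) : Prop :=
  ∀ t ∈ ts, t.Holds ![level lo hi (F w), level (N - hi) (N - lo) (F (q + w)),
    level lo' hi' (F w'), level (N - hi') (N - lo') (F (q + w'))]

/-- The constraints of the instance built from a graph on `n` vertices and the number `k`, where
`E v u` for `u < v` is adjacency. The variable `i * k + j` is meant to have the value `a * n + b`
with `a` and `b` the `i`-th and `j`-th vertex of an independent set. The first conjunct forces the
variables `k * k + v` to be the reversals of the variables `v`, the second says that `a` depends on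
`i` only, the third that exchanging `i` and `j` exchanges `a` and `b`, and the last excludes that
`a` and `b` are equal or adjacent. -/
def IsSolution {Γ : Language} (xs is : List (Template Γ)) (n k : ℕ) (E : ℕ → ℕ → Prop)
    (F : ℕ → ℕ) : Prop :=
  (∀ v < k * k, ∀ a < n * n, PairHolds xs (n * n) (k * k) F v a a v a a) ∧
  (∀ i < k, ∀ j < k, ∀ a < n, PairHolds is (n * n) (k * k) F
    (i * k + j) (a * n) (a * n + n) (i * k + i) (a * n) (a * n + n)) ∧
  (∀ i < k, ∀ j < k, ∀ a < n, ∀ b < n,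
    PairHolds is (n * n) (k * k) F
      (i * k + j) (a * n + b) (a * n + b + 1) (j * k + i) (b * n + a) (b * n + a + 1) ∧
    (i ≠ j → b ≤ a → (b < a → E a b) → PairHolds is (n * n) (k * k) F
      (i * k + j) (a * n + b) (a * n + b + 1) (i * k + j) 0 0))

theorem mul_add_lt {a b n : ℕ} (ha : a < n) (hb : b < n) : a * n + b < n * n :=
  calc a * n + b < (a + 1) * n := by rw [add_mul, one_mul]; omega
    _ ≤ n * n := Nat.mul_le_mul_right _ ha

theorem mul_add_le {a n : ℕ} (ha : a < n) : a * n + n ≤ n * n :=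
  calc a * n + n = (a + 1) * n := by rw [add_mul, one_mul]
    _ ≤ n * n := Nat.mul_le_mul_right _ ha

theorem mul_le_and_lt_iff {a c n : ℕ} (hn : 0 < n) : a * n ≤ c ∧ c < a * n + n ↔ c / n = a := by
  rw [Nat.div_eq_iff hn]
  omega

section Solution

variable {Γ : Language} {xs is : List (Template Γ)} {n k : ℕ} {E : ℕ → ℕ → Prop} {F : ℕ → ℕ}

theorem pairHolds_xor_iff (hxs : ∀ p, p 0 ≠ 1 → p 1 ≠ 1 → ((∀ t ∈ xs, t.Holds p) ↔ p 0 ≠ p 1))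
    (N q v a : ℕ) : PairHolds xs N q F v a a v a a ↔ (F v < a ↔ ¬ F (q + v) < N - a) := by
  unfold PairHolds
  rw [hxs]
  · simp only [Matrix.cons_val_zero, Matrix.cons_val_one, level_self]
    split_ifs with h1 h2 <;> simp [*]
  · simp only [Matrix.cons_val_zero, level_self]
    split_ifs <;> simp
  · simp only [Matrix.cons_val_one, Matrix.cons_val_zero, level_self]
    split_ifs <;> simp

/-- Thresholds at all positions force two variables to be reversals of each other. -/
theorem pairHolds_xor_all_iff
    (hxs : ∀ p, p 0 ≠ 1 → p 1 ≠ 1 → ((∀ t ∈ xs, t.Holds p) ↔ p 0 ≠ p 1)) {N q v : ℕ}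
    (hv : F v < N) :
    (∀ a < N, PairHolds xs N q F v a a v a a) ↔ F v + F (q + v) + 1 = N := by
  simp only [pairHolds_xor_iff hxs]
  constructor
  · intro h
    -- The threshold `F v` gives `F (q + v) ≤ N - 1 - F v`, and the threshold `F v + 1` equality.
    have h1 := h (F v) hv
    by_cases h2 : F v + 1 < N
    · have h3 := h (F v + 1) h2
      omega
    · omega
  · intro h a ha
    omega

theorem pairHolds_iff_iff (his : ∀ a b, (∀ t ∈ is, t.Holds (slots a b)) ↔ (a = 1 ↔ b = 1))
    {N q w lo hi w' lo' hi' : ℕ} (h : F w + F (q + w) + 1 = N) (h' : F w' + F (q + w') + 1 = N)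
    (hl : lo ≤ hi) (hN : hi ≤ N) (hl' : lo' ≤ hi') (hN' : hi' ≤ N) :
    PairHolds is N q F w lo hi w' lo' hi' ↔
      (lo ≤ F w ∧ F w < hi ↔ lo' ≤ F w' ∧ F w' < hi') := by
  unfold PairHolds
  rw [level_rev hl hN h, level_rev hl' hN' h', ← level_eq_one, ← level_eq_one]
  exact his _ _

/-- The meaning of the constraints once the templates are interpreted. -/
theorem isSolution_iff (hxs : ∀ p, p 0 ≠ 1 → p 1 ≠ 1 → ((∀ t ∈ xs, t.Holds p) ↔ p 0 ≠ p 1))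
    (his : ∀ a b, (∀ t ∈ is, t.Holds (slots a b)) ↔ (a = 1 ↔ b = 1))
    (hF : ∀ v < k * k + k * k, F v < n * n) :
    IsSolution xs is n k E F ↔ (∀ v < k * k, F v + F (k * k + v) + 1 = n * n) ∧
      (∀ i < k, ∀ j < k, ∀ a < n, F (i * k + j) / n = a ↔ F (i * k + i) / n = a) ∧
      (∀ i < k, ∀ j < k, ∀ a < n, ∀ b < n,
        (F (i * k + j) = a * n + b ↔ F (j * k + i) = b * n + a) ∧
        (i ≠ j → b ≤ a → (b < a → E a b) → F (i * k + j) ≠ a * n + b)) := by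
  have hrev : (∀ v < k * k, ∀ a < n * n, PairHolds xs (n * n) (k * k) F v a a v a a) ↔
      ∀ v < k * k, F v + F (k * k + v) + 1 = n * n :=
    forall₂_congr fun v hv =>
      pairHolds_xor_all_iff hxs (hF v (by omega))
  unfold IsSolution
  rw [hrev]
  refine and_congr_right fun hr => and_congr ?_ ?_
  · refine forall₂_congr fun i hi => forall₂_congr fun j hj => forall₂_congr fun a ha => ?_
    have hn : 0 < n := by omega
    rw [pairHolds_iff_iff his (hr _ (mul_add_lt hi hj)) (hr _ (mul_add_lt hi hi)) (by omega)
      (mul_add_le ha) (by omega) (mul_add_le ha), mul_le_and_lt_iff hn, mul_le_and_lt_iff hn]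
  · refine forall₂_congr fun i hi => forall₂_congr fun j hj => forall₂_congr fun a ha =>
      forall₂_congr fun b hb => and_congr ?_ ?_
    · rw [pairHolds_iff_iff his (hr _ (mul_add_lt hi hj)) (hr _ (mul_add_lt hj hi)) (by omega)
        (mul_add_lt ha hb) (by omega) (mul_add_lt hb ha)]
      omega
    · refine imp_congr_right fun _ => imp_congr_right fun _ => imp_congr_right fun _ => ?_
      rw [pairHolds_iff_iff his (hr _ (mul_add_lt hi hj)) (hr _ (mul_add_lt hi hj)) (by omega)
        (mul_add_lt ha hb) le_rfl (Nat.zero_le _)]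
      omega

variable {G : SimpleGraph (Fin n)}

/-- The vertices of the independent set are read off the variables `i * k + i`. -/
theorem IsSolution.exists_isNIndepSet
    (hxs : ∀ p, p 0 ≠ 1 → p 1 ≠ 1 → ((∀ t ∈ xs, t.Holds p) ↔ p 0 ≠ p 1))
    (his : ∀ a b, (∀ t ∈ is, t.Holds (slots a b)) ↔ (a = 1 ↔ b = 1))
    (hE : ∀ u v : Fin n, u < v → (E v u ↔ G.Adj u v))
    (hF : ∀ v < k * k + k * k, F v < n * n) (h : IsSolution xs is n k E F) :
    ∃ S : Finset (Fin n), G.IsNIndepSet k S := by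
  obtain ⟨-, h2, h3⟩ := (isSolution_iff hxs his hF).1 h
  have hlt : ∀ i < k, ∀ j < k, F (i * k + j) < n * n := fun i hi j hj =>
    hF _ ((mul_add_lt hi hj).trans_le (Nat.le_add_right _ _))
  let u : Fin k → Fin n := fun i =>
    ⟨F (i * k + i) / n, Nat.div_lt_of_lt_mul (hlt i i.2 i i.2)⟩
  have hrow : ∀ i j : Fin k, F (i * k + j) / n = u i := fun i j =>
    (h2 i i.2 j j.2 (u i) (u i).2).2 rfl
  -- The remainder of the value at `(i, j)` is the quotient of the value at `(j, i)`.
  have hval : ∀ i j : Fin k, F (i * k + j) = u i * n + u j := by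
    intro i j
    have hn : 0 < n := (u i).pos
    have hmod := Nat.mod_lt (F (i * k + j)) hn
    have e := Nat.div_add_mod' (F (i * k + j)) n
    rw [hrow i j] at e
    have hsw := (h3 i i.2 j j.2 (u i) (u i).2 _ hmod).1.1 e.symm
    have : F (j * k + i) / n = F (i * k + j) % n := by
      rw [hsw]
      exact (mul_le_and_lt_iff hn).1 ⟨by omega, by have := (u i).2; omega⟩
    rw [hrow j i] at this
    rw [this, e]
  -- The exclusions cover the pairs with `u j ≤ u i`; the others follow by exchanging `i` and `j`.
  have hbad : ∀ i j : Fin k, i ≠ j → u j ≤ u i → u j < u i ∧ ¬ G.Adj (u j) (u i) := by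
    intro i j hij hle
    have hnb := (h3 i i.2 j j.2 (u i) (u i).2 (u j) (u j).2).2 (fun h => hij (Fin.ext h)) hle
    constructor
    · rw [lt_iff_le_and_ne]
      refine ⟨hle, fun heq => hnb (fun hl => ?_) (hval i j)⟩
      rw [heq] at hl
      exact absurd hl (lt_irrefl _)
    · exact fun hadj => hnb (fun hl => (hE _ _ hl).2 hadj) (hval i j)
  have hinj : Function.Injective u := by
    intro i j hij
    by_contra hne
    exact (hbad i j hne hij.ge).1.ne hij.symm
  refine ⟨Finset.univ.map ⟨u, hinj⟩, ?_, by simp⟩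
  intro a ha b hb hab
  simp only [Finset.coe_map, Function.Embedding.coeFn_mk, Finset.coe_univ, Set.image_univ,
    Set.mem_range] at ha hb
  obtain ⟨i, rfl⟩ := ha
  obtain ⟨j, rfl⟩ := hb
  have hij : i ≠ j := fun h => hab (by rw [h])
  rcases le_total (u i) (u j) with h | h
  · exact (hbad j i hij.symm h).2
  · exact fun hadj => (hbad i j hij h).2 hadj.symm

/-- An enumeration `u` of an independent set gives the solution with value `u i * n + u j` at
`i * k + j`. -/
theorem exists_isSolution
    (hxs : ∀ p, p 0 ≠ 1 → p 1 ≠ 1 → ((∀ t ∈ xs, t.Holds p) ↔ p 0 ≠ p 1))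
    (his : ∀ a b, (∀ t ∈ is, t.Holds (slots a b)) ↔ (a = 1 ↔ b = 1))
    (hE : ∀ u v : Fin n, u < v → (E v u ↔ G.Adj u v)) (hk : 1 ≤ k)
    {S : Finset (Fin n)} (hS : G.IsNIndepSet k S) :
    ∃ f : Fin (k * k + k * k) → Fin (n * n), IsSolution xs is n k E (value f) := by
  let e := S.equivFinOfCardEq hS.card_eq
  let u : ℕ → Fin n := fun i => (e.symm ⟨i % k, Nat.mod_lt i hk⟩).1
  have hu : ∀ i < k, ∀ j < k, u i = u j → i = j := by
    intro i hi j hj h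
    have := e.symm.injective (Subtype.ext h)
    rw [Fin.mk.injEq, Nat.mod_eq_of_lt hi, Nat.mod_eq_of_lt hj] at this
    exact this
  have hn : 0 < n := (u 0).pos
  let z : ℕ → ℕ := fun v => u (v / k) * n + u v
  have hz : ∀ v, z v < n * n := fun v => mul_add_lt (u _).2 (u _).2
  let f : Fin (k * k + k * k) → Fin (n * n) := fun v =>
    if v.1 < k * k then ⟨z v, hz v⟩ else Fin.rev ⟨z (v - k * k), hz _⟩
  have hf1 : ∀ v < k * k, value f v = z v := by
    intro v hv
    rw [value_of_lt f (by omega)]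
    simp [f, hv]
  have hf2 : ∀ v < k * k, value f (k * k + v) = n * n - (z v + 1) := by
    intro v hv
    rw [value_of_lt f (by omega)]
    simp [f]
  have hzij : ∀ i < k, ∀ j < k, value f (i * k + j) = u i * n + u j := by
    intro i hi j hj
    rw [hf1 _ (mul_add_lt hi hj)]
    have h1 : (i * k + j) / k = i := (mul_le_and_lt_iff hk).1 ⟨by omega, by omega⟩
    have h2 : u (i * k + j) = u j := by simp [u]
    simp only [z, h1, h2]
  have hdiv : ∀ a b : ℕ, b < n → (a * n + b) / n = a := fun a b hb =>
    (mul_le_and_lt_iff hn).1 ⟨by omega, by omega⟩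
  have hdec : ∀ a b c d : ℕ, b < n → d < n → (a * n + b = c * n + d ↔ a = c ∧ b = d) := by
    intro a b c d hb hd
    constructor
    · intro h
      have h1 : a = c := by rw [← hdiv a b hb, h, hdiv c d hd]
      subst h1
      exact ⟨rfl, by omega⟩
    · rintro ⟨rfl, rfl⟩
      rfl
  refine ⟨f, (isSolution_iff hxs his fun v hv => ?_).2 ⟨fun v hv => ?_, ?_, ?_⟩⟩
  · rw [value_of_lt f hv]
    exact (f _).2
  · rw [hf1 v hv, hf2 v hv]
    have := hz v
    omega
  · intro i hi j hj a ha
    rw [hzij i hi j hj, hzij i hi i hi, hdiv _ _ (u j).2, hdiv _ _ (u i).2]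
  · intro i hi j hj a ha b hb
    rw [hzij i hi j hj, hzij j hj i hi]
    refine ⟨?_, fun hij hba hadj h => ?_⟩
    · rw [hdec _ _ _ _ (u j).2 hb, hdec _ _ _ _ (u i).2 ha, and_comm]
    · rw [hdec _ _ _ _ (u j).2 hb] at h
      obtain ⟨rfl, rfl⟩ := h
      have hne : u j ≠ u i := fun h => hij (hu i hi j hj h.symm)
      have hlt : u j < u i := lt_of_le_of_ne hba hne
      exact hS.isIndepSet (e.symm _).2 (e.symm _).2 hne ((hE _ _ hlt).1 (hadj hlt))

end Solution

/-! ### The reduction as an emitter -/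

namespace Emitter

variable {x : List (Fin 2)} {env : List ℕ}

/-- As many ones as the value of `r`. -/
def ones (r : ℕ) : Emitter := loop r (sym 1)

/-- A fixed string. -/
def const (l : List (Fin 2)) : Emitter := l.foldr (fun a e => cat (sym a) e) nil

/-- The concatenation of a fixed list of emitters. -/
def join (es : List Emitter) : Emitter := es.foldr cat nil

/-- A string of length `r * s + t`. -/
def mulAdd (r s t : ℕ) : Emitter := cat (loop r (ones s)) (ones t)

/-- A string of length `tri r`, for an environment of length `D`. -/
def triE (D r : ℕ) : Emitter := loop r (ones D)

/-- A string of length `r - s`, for an environment of length `D`. -/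
def subE (D r s : ℕ) : Emitter := loop r (lt D s nil (sym 1))

/-- The code of the map `c ∘ level lo hi` on `{0, …, N - 1}`, for an environment of length `D`. -/
def table (D N lo hi : ℕ) (c : Fin 3 → ℕ) : Emitter :=
  loop N (lt D lo (const (unary (c 0))) (lt D hi (const (unary (c 1))) (const (unary (c 2)))))

/-- The argument of a constraint that reads the variable `w` relative to `[lo, hi)`. -/
def plainArg (D N w lo hi : ℕ) (c : Fin 3 → ℕ) : Emitter :=
  cat (cat (ones w) (sym 0)) (table D N lo hi c)

/-- The argument of a constraint that reads the variable `q + w` relative to `[N - hi, N - lo)`. -/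
def revArg (D N q w lo hi : ℕ) (c : Fin 3 → ℕ) : Emitter :=
  cat (cat (ones q) (cat (ones w) (sym 0)))
    (len (subE (D + 1) N hi) (len (subE (D + 2) N lo) (table (D + 2) N D (D + 1) c)))

/-- The codes of the constraints in `PairHolds`, for an environment of length `D`. -/
def pair {Γ : Language} (ts : List (Template Γ)) (D N q w lo hi w' lo' hi' : ℕ) : Emitter :=
  join (ts.map fun t => cat (const (unary t.rel)) (join
    ((List.finRange (Γ.get t.rel).arity).map fun i =>
      ![plainArg D N w lo hi, revArg D N q w lo hi, plainArg D N w' lo' hi',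
        revArg D N q w' lo' hi'] (t.slot i) fun p => t.val i p)))

theorem denote_ones (r : ℕ) : denote x (ones r) env = List.replicate (env.getD r 0) 1 := by
  simp [ones, denote, List.eq_replicate_iff]

theorem denote_const (l : List (Fin 2)) : denote x (const l) env = l := by
  induction l with
  | nil => rfl
  | cons a l ih => exact congrArg (a :: ·) ih

theorem denote_join (es : List Emitter) :
    denote x (join es) env = es.flatMap fun e => denote x e env := by
  induction es with
  | nil => rfl
  | cons e es ih => exact congrArg (denote x e env ++ ·) ih

theorem denote_cat (e f : Emitter) : denote x (cat e f) env = denote x e env ++ denote x f env :=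
  rfl

theorem denote_len {e f : Emitter} {a : ℕ} (h : (denote x e (env ++ [0])).length = a) :
    denote x (len e f) env = denote x f (env ++ [a]) := by rw [denote, h]

theorem getD_append_of_lt {r : ℕ} (hr : r < env.length) (l : List ℕ) :
    (env ++ l).getD r 0 = env.getD r 0 := List.getD_append _ _ _ _ hr

theorem getD_append_length (i : ℕ) : (env ++ [i]).getD env.length 0 = i := by simp

theorem length_mulAdd {r s t a b c : ℕ} (hr : env.getD r 0 = a) (hs : env.getD s 0 = b)
    (ht : env.getD t 0 = c) (hlt : s < env.length) :
    (denote x (mulAdd r s t) env).length = a * b + c := by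
  simp only [mulAdd, denote, denote_ones, List.length_append, List.length_flatMap, hr, ht,
    getD_append_of_lt hlt, hs, List.length_replicate]
  simp

theorem length_triE {r : ℕ} : (denote x (triE env.length r) env).length = tri (env.getD r 0) := by
  simp only [triE, denote, denote_ones, List.length_flatMap, getD_append_length,
    List.length_replicate, tri]
  rfl

theorem length_subE {r s : ℕ} (hlt : s < env.length) :
    (denote x (subE env.length r s) env).length = env.getD r 0 - env.getD s 0 := by
  simp only [subE, denote, getD_append_length, getD_append_of_lt hlt]
  generalize env.getD r 0 = m
  generalize env.getD s 0 = b
  induction m with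
  | zero => simp
  | succ m ih =>
    rw [flatMap_range_succ, List.length_append, ih]
    split_ifs <;> simp <;> omega

theorem denote_table {N lo hi : ℕ} (hlo : lo < env.length) (hhi : hi < env.length)
    (c : Fin 3 → ℕ) : denote x (table env.length N lo hi c) env =
      (List.range (env.getD N 0)).flatMap fun a =>
        unary (c (level (env.getD lo 0) (env.getD hi 0) a)) := by
  simp only [table, denote, getD_append_length, getD_append_of_lt hlo, getD_append_of_lt hhi,
    denote_const]
  congr 1
  funext a
  unfold level
  split_ifs <;> rfl

theorem denote_plainArg {N w lo hi : ℕ} (hlo : lo < env.length) (hhi : hi < env.length)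
    (c : Fin 3 → ℕ) : denote x (plainArg env.length N w lo hi c) env =
      unary (env.getD w 0) ++ (List.range (env.getD N 0)).flatMap fun a =>
        unary (c (level (env.getD lo 0) (env.getD hi 0) a)) := by
  simp only [plainArg, denote, denote_ones, denote_table hlo hhi, unary]

theorem denote_revArg {N q w lo hi : ℕ} (hlo : lo < env.length) (hhi : hi < env.length)
    (hN : N < env.length) (c : Fin 3 → ℕ) : denote x (revArg env.length N q w lo hi c) env =
      unary (env.getD q 0 + env.getD w 0) ++ (List.range (env.getD N 0)).flatMap fun a =>
        unary (c (level (env.getD N 0 - env.getD hi 0) (env.getD N 0 - env.getD lo 0) a)) := by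
  have h1 : (denote x (subE (env.length + 1) N hi) (env ++ [0])).length =
      env.getD N 0 - env.getD hi 0 := by
    have := length_subE (x := x) (env := env ++ [0]) (r := N) (s := hi) (by simp; omega)
    rwa [getD_append_of_lt hN, getD_append_of_lt hhi, List.length_append,
      List.length_singleton] at this
  set d := env.getD N 0 - env.getD hi 0
  have h2 : (denote x (subE (env.length + 2) N lo) ((env ++ [d]) ++ [0])).length =
      env.getD N 0 - env.getD lo 0 := by
    rw [List.append_assoc]
    have := length_subE (x := x) (env := env ++ ([d] ++ [0])) (r := N) (s := lo) (by simp; omega)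
    rw [getD_append_of_lt hN, getD_append_of_lt hlo, List.length_append] at this
    exact this
  set d' := env.getD N 0 - env.getD lo 0
  have h3 := denote_table (x := x) (env := (env ++ [d]) ++ [d']) (N := N) (lo := env.length)
    (hi := env.length + 1) (by simp) (by simp) c
  have e1 : ((env ++ [d]) ++ [d']).getD env.length 0 = d := by simp
  have e2 : ((env ++ [d]) ++ [d']).getD (env.length + 1) 0 = d' := by simp
  have e3 : ((env ++ [d]) ++ [d']).getD N 0 = env.getD N 0 := by
    rw [List.append_assoc, getD_append_of_lt hN]
  have e4 : ((env ++ [d]) ++ [d']).length = env.length + 2 := by simp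
  rw [e1, e2, e3, e4] at h3
  rw [revArg, denote_cat, denote_len h1, denote_len h2, h3]
  simp only [denote, denote_ones, unary, List.replicate_add, List.append_assoc]

theorem encodes_pair {Γ : Language} (ts : List (Template Γ)) {N q w lo hi w' lo' hi' : ℕ}
    {vN vq vw vlo vhi vw' vlo' vhi' D : ℕ} (hD : env.length = D)
    (eN : env.getD N 0 = vN) (eq : env.getD q 0 = vq)
    (ew : env.getD w 0 = vw) (elo : env.getD lo 0 = vlo) (ehi : env.getD hi 0 = vhi)
    (ew' : env.getD w' 0 = vw') (elo' : env.getD lo' 0 = vlo') (ehi' : env.getD hi' 0 = vhi')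
    (hN : N < D) (hlo : lo < D) (hhi : hi < D) (hlo' : lo' < D) (hhi' : hi' < D)
    (hw : vw < vq) (hw' : vw' < vq) :
    Encodes Γ vN (vq + vq) (denote x (pair ts D N q w lo hi w' lo' hi') env) fun f =>
      PairHolds ts vN vq (value f) vw vlo vhi vw' vlo' vhi' := by
  subst hD eN eq ew elo ehi ew' elo' ehi'
  set vN := env.getD N 0
  set vq := env.getD q 0
  let W : Fin 4 → ℕ := ![env.getD w 0, vq + env.getD w 0, env.getD w' 0, vq + env.getD w' 0]
  let L : Fin 4 → ℕ := ![env.getD lo 0, vN - env.getD hi 0, env.getD lo' 0, vN - env.getD hi' 0]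
  let H : Fin 4 → ℕ := ![env.getD hi 0, vN - env.getD lo 0, env.getD hi' 0, vN - env.getD lo' 0]
  have hW : ∀ s, W s < vq + vq := by
    intro s
    fin_cases s
    · change env.getD w 0 < vq + vq; omega
    · change vq + env.getD w 0 < vq + vq; omega
    · change env.getD w' 0 < vq + vq; omega
    · change vq + env.getD w' 0 < vq + vq; omega
  have harg : ∀ (s : Fin 4) (c : Fin 3 → ℕ),
      denote x (![plainArg env.length N w lo hi, revArg env.length N q w lo hi,
        plainArg env.length N w' lo' hi', revArg env.length N q w' lo' hi'] s c) env =
      unary (W s) ++ (List.range vN).flatMap fun a => unary (c (level (L s) (H s) a)) := by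
    intro s c
    fin_cases s
    · exact denote_plainArg hlo hhi c
    · exact denote_revArg hlo hhi hN c
    · exact denote_plainArg hlo' hhi' c
    · exact denote_revArg hlo' hhi' hN c
  refine (Encodes.flatMap ts fun t _ => t.encodes W L H hW).congr ?_ fun f => ?_
  · rw [pair, denote_join, List.flatMap_map]
    congr 1
    funext t
    simp only [denote, denote_const, denote_join, List.flatMap_map, harg]
  · refine forall₂_congr fun t _ => ?_
    have : (fun s => level (L s) (H s) (value f (W s))) =
        ![level (env.getD lo 0) (env.getD hi 0) (value f (env.getD w 0)),
          level (vN - env.getD hi 0) (vN - env.getD lo 0) (value f (vq + env.getD w 0)),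
          level (env.getD lo' 0) (env.getD hi' 0) (value f (env.getD w' 0)),
          level (vN - env.getD hi' 0) (vN - env.getD lo' 0) (value f (vq + env.getD w' 0))] := by
      funext s
      fin_cases s <;> rfl
    rw [this]

/-- If the input is the code of a graph on `n` vertices, where `n` is the variable `3` and the last
one, this is `body` in the environment extended by `n + 1 + tri n` and `0`; otherwise it is the empty
string. The variable `4` is the required length of the input, and `5` counts the wrong symbols among
its first `n + 1`. -/
def guardCode (body : Emitter) : Emitter :=
  len (cat (ones 3) (cat (sym 1) (triE 5 3)))
    (lt 4 0 nil (lt 0 4 nil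
      (len (cat (loop 3 (bit 6 nil (sym 1))) (bit 3 (sym 1) nil)) (lt 2 5 nil body))))

/-- The third part of `IsSolution`, for `i`, `j`, `a`, `b` the variables `9`, …, `12`. The new
variables `13`, …, `18` are `i * k + j`, `j * k + i`, and the ends of the intervals `{a * n + b}` and
`{b * n + a}`. -/
def cellConstraints {Γ : Language} (is : List (Template Γ)) : Emitter :=
  len (mulAdd 9 1 10) (len (mulAdd 10 1 9) (len (mulAdd 11 3 12)
    (len (cat (mulAdd 11 3 12) (sym 1)) (len (mulAdd 12 3 11) (len (cat (mulAdd 12 3 11) (sym 1))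
      (cat (pair is 19 6 7 13 15 16 14 17 18) (lt 9 10 (bad is) (lt 10 9 (bad is) nil))))))))
where
  /-- The exclusion of the value `a * n + b` if `a = b` or if `b < a` and the input has an edge
  there. -/
  bad {Γ : Language} (is : List (Template Γ)) : Emitter :=
    lt 11 12 nil (lt 12 11
      (len (cat (ones 3) (cat (sym 1) (cat (triE 20 11) (ones 12))))
        (bit 19 (pair is 20 6 7 13 15 16 13 2 2) nil))
      (pair is 19 6 7 13 15 16 13 2 2))

/-- The second part of `IsSolution`, for `i`, `j`, `a` the variables `9`, `10`, `11`. -/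
def rowConstraints {Γ : Language} (is : List (Template Γ)) : Emitter :=
  len (mulAdd 9 1 10) (len (mulAdd 9 1 9) (len (mulAdd 11 3 2) (len (mulAdd 11 3 3)
    (pair is 16 6 7 12 14 15 13 14 15))))

/-- The code of the instance with the constraints `IsSolution`. The variables are `0`: length of the
input, `1`: `k`, `2`: the constant `0`, `3`: `n`, `4` and `5`: unused; then `6`: `n * n`,
`7`: `k * k`, `8`: `k * k + k * k` are added. -/
def instanceCode {Γ : Language} (xs is : List (Template Γ)) : Emitter :=
  len (mulAdd 3 3 2) (len (mulAdd 1 1 2) (len (cat (ones 7) (ones 7))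
    (cat (cat (cat (ones 6) (sym 0)) (cat (ones 8) (sym 0)))
      (cat (loop 7 (loop 6 (pair xs 11 6 7 9 10 10 9 10 10)))
        (cat (loop 1 (loop 1 (loop 3 (rowConstraints is))))
          (loop 1 (loop 1 (loop 3 (loop 3 (cellConstraints is))))))))))

/-- The output string of the reduction: for `k > 0`, the concatenation over all `n` of the instances
for the graphs on `n` vertices that the input encodes. At most one of them is not empty, and none is
if the input is no graph code or `k = 0`; the output is then no instance at all. -/
def reduction {Γ : Language} (xs is : List (Template Γ)) : Emitter :=
  len nil (lt 2 1 (loop 0 (guardCode (instanceCode xs is))) nil)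

theorem isGraphCode_iff {n : ℕ} : IsGraphCode x n ↔
    x.length = n + 1 + tri n ∧ (∀ t < n, x[t]? = some 1) ∧ x[n]? ≠ some 1 :=
  ⟨fun h => ⟨h.1, h.2, h.3⟩, fun h => ⟨h.1, h.2.1, h.2.2⟩⟩

open Classical in
theorem denote_guardCode (body : Emitter) (k n : ℕ) :
    denote x (guardCode body) [x.length, k, 0, n] =
      if IsGraphCode x n then denote x body [x.length, k, 0, n, n + 1 + tri n, 0] else [] := by
  have h1 : (denote x (cat (ones 3) (cat (sym 1) (triE 5 3)))
      ([x.length, k, 0, n] ++ [0])).length = n + 1 + tri n := by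
    have := length_triE (x := x) (env := [x.length, k, 0, n, 0]) (r := 3)
    simp only [denote_ones, denote, List.length_append, List.length_replicate]
    simp at this ⊢
    omega
  set w := denote x (cat (loop 3 (bit 6 nil (sym 1))) (bit 3 (sym 1) nil))
    ([x.length, k, 0, n] ++ [n + 1 + tri n] ++ [0]) with hw
  have h2 : w.length = 0 ↔ (∀ t < n, x[t]? = some 1) ∧ x[n]? ≠ some 1 := by
    have hloop : denote x (loop 3 (bit 6 nil (sym 1)))
        ([x.length, k, 0, n] ++ [n + 1 + tri n] ++ [0]) =
        (List.range n).flatMap fun t => if x[t]? = some 1 then [] else [1] := rfl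
    have hbit : denote x (bit 3 (sym 1) nil) ([x.length, k, 0, n] ++ [n + 1 + tri n] ++ [0]) =
        if x[n]? = some 1 then [1] else [] := rfl
    rw [List.length_eq_zero_iff, hw, denote_cat, hloop, hbit]
    simp
  have h3 : denote x (guardCode body) [x.length, k, 0, n] =
      if n + 1 + tri n < x.length then [] else if x.length < n + 1 + tri n then [] else
        if 0 < w.length then [] else denote x body [x.length, k, 0, n, n + 1 + tri n, w.length] := by
    rw [guardCode, denote_len h1]
    rfl
  rw [h3]
  by_cases hx : IsGraphCode x n
  · obtain ⟨e1, e2⟩ := isGraphCode_iff.1 hx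
    rw [if_neg (by omega), if_neg (by omega), h2.2 e2, if_neg (by omega), if_pos hx]
  · rw [if_neg hx]
    split_ifs with g1 g2 g3
    · rfl
    · rfl
    · rfl
    · exact absurd (isGraphCode_iff.2 ⟨by omega, h2.1 (by omega)⟩) hx

theorem encodes_rowConstraints {Γ : Language} (is : List (Template Γ)) {k n i j a m L : ℕ}
    (hi : i < k) (hj : j < k) :
    Encodes Γ (n * n) (k * k + k * k) (denote x (rowConstraints is)
      [L, k, 0, n, m, 0, n * n, k * k, k * k + k * k, i, j, a]) fun f =>
      PairHolds is (n * n) (k * k) (value f)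
        (i * k + j) (a * n) (a * n + n) (i * k + i) (a * n) (a * n + n) := by
  rw [rowConstraints, denote_len (length_mulAdd rfl rfl rfl (by simp)),
    denote_len (length_mulAdd rfl rfl rfl (by simp)),
    denote_len (length_mulAdd rfl rfl rfl (by simp)),
    denote_len (length_mulAdd rfl rfl rfl (by simp))]
  exact encodes_pair is rfl rfl rfl rfl rfl rfl rfl rfl rfl (by norm_num) (by norm_num) (by norm_num)
    (by norm_num) (by norm_num) (mul_add_lt hi hj) (mul_add_lt hi hi)

theorem encodes_cellConstraints {Γ : Language} (is : List (Template Γ)) {k n i j a b m L : ℕ}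
    (hi : i < k) (hj : j < k) :
    Encodes Γ (n * n) (k * k + k * k) (denote x (cellConstraints is)
      [L, k, 0, n, m, 0, n * n, k * k, k * k + k * k, i, j, a, b]) fun f =>
      PairHolds is (n * n) (k * k) (value f)
        (i * k + j) (a * n + b) (a * n + b + 1) (j * k + i) (b * n + a) (b * n + a + 1) ∧
      (i ≠ j → b ≤ a → (b < a → x[n + 1 + tri a + b]? = some 1) → PairHolds is (n * n) (k * k)
        (value f) (i * k + j) (a * n + b) (a * n + b + 1) (i * k + j) 0 0) := by
  have hsucc : ∀ (env : List ℕ) (r s t u v w : ℕ), env.getD r 0 = u → env.getD s 0 = v →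
      env.getD t 0 = w → s < env.length →
      (denote x (cat (mulAdd r s t) (sym 1)) env).length = u * v + w + 1 := by
    intro env r s t u v w hr hs ht hlt
    rw [denote_cat, List.length_append, length_mulAdd hr hs ht hlt]
    rfl
  rw [cellConstraints, denote_len (length_mulAdd rfl rfl rfl (by simp)),
    denote_len (length_mulAdd rfl rfl rfl (by simp)),
    denote_len (length_mulAdd rfl rfl rfl (by simp)),
    denote_len (hsucc _ _ _ _ _ _ _ rfl rfl rfl (by simp)),
    denote_len (length_mulAdd rfl rfl rfl (by simp)),
    denote_len (hsucc _ _ _ _ _ _ _ rfl rfl rfl (by simp)), denote_cat]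
  simp only [List.cons_append, List.nil_append]
  have hbad : Encodes Γ (n * n) (k * k + k * k) (denote x (cellConstraints.bad is)
      [L, k, 0, n, m, 0, n * n, k * k, k * k + k * k, i, j, a, b, i * k + j, j * k + i, a * n + b,
        a * n + b + 1, b * n + a, b * n + a + 1]) fun f =>
      b ≤ a → (b < a → x[n + 1 + tri a + b]? = some 1) → PairHolds is (n * n) (k * k)
        (value f) (i * k + j) (a * n + b) (a * n + b + 1) (i * k + j) 0 0 := by
    have hbit : Encodes Γ (n * n) (k * k + k * k)
        (denote x (len (cat (ones 3) (cat (sym 1) (cat (triE 20 11) (ones 12))))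
          (bit 19 (pair is 20 6 7 13 15 16 13 2 2) nil))
        [L, k, 0, n, m, 0, n * n, k * k, k * k + k * k, i, j, a, b, i * k + j, j * k + i, a * n + b,
          a * n + b + 1, b * n + a, b * n + a + 1]) fun f =>
        (x[n + 1 + tri a + b]? = some 1 → PairHolds is (n * n) (k * k)
          (value f) (i * k + j) (a * n + b) (a * n + b + 1) (i * k + j) 0 0) ∧
        (¬ x[n + 1 + tri a + b]? = some 1 → True) := by
      rw [denote_len (a := n + 1 + tri a + b)]
      · exact Encodes.ite (fun _ => encodes_pair is rfl rfl rfl rfl rfl rfl rfl rfl rfl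
          (by norm_num) (by norm_num) (by norm_num) (by norm_num) (by norm_num)
          (mul_add_lt hi hj) (mul_add_lt hi hj)) fun _ => Encodes.nil
      · have := length_triE (x := x) (env := [L, k, 0, n, m, 0, n * n, k * k, k * k + k * k, i, j, a,
          b, i * k + j, j * k + i, a * n + b, a * n + b + 1, b * n + a, b * n + a + 1, 0]) (r := 11)
        simp only [denote_ones, denote, List.length_append, List.length_replicate]
        simp at this ⊢
        omega
    have hexcl : Encodes Γ (n * n) (k * k + k * k)
        (denote x (pair is 19 6 7 13 15 16 13 2 2)
        [L, k, 0, n, m, 0, n * n, k * k, k * k + k * k, i, j, a, b, i * k + j, j * k + i, a * n + b,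
          a * n + b + 1, b * n + a, b * n + a + 1]) fun f =>
        PairHolds is (n * n) (k * k) (value f)
          (i * k + j) (a * n + b) (a * n + b + 1) (i * k + j) 0 0 :=
      encodes_pair is rfl rfl rfl rfl rfl rfl rfl rfl rfl
        (by norm_num) (by norm_num) (by norm_num) (by norm_num) (by norm_num)
        (mul_add_lt hi hj) (mul_add_lt hi hj)
    refine (Encodes.ite (p := a < b) (fun _ => Encodes.nil) fun _ => Encodes.ite (p := b < a)
      (fun _ => hbit) fun _ => hexcl).congr rfl fun f => ?_
    rcases lt_trichotomy a b with h | rfl | h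
    · simp [h, h.not_ge]
    · simp
    · simp [h, h.not_gt, h.le]
  have hswap : Encodes Γ (n * n) (k * k + k * k)
      (denote x (pair is 19 6 7 13 15 16 14 17 18)
      [L, k, 0, n, m, 0, n * n, k * k, k * k + k * k, i, j, a, b, i * k + j, j * k + i, a * n + b,
        a * n + b + 1, b * n + a, b * n + a + 1]) fun f =>
      PairHolds is (n * n) (k * k) (value f)
        (i * k + j) (a * n + b) (a * n + b + 1) (j * k + i) (b * n + a) (b * n + a + 1) :=
    encodes_pair is rfl rfl rfl rfl rfl rfl rfl rfl rfl
      (by norm_num) (by norm_num) (by norm_num) (by norm_num) (by norm_num)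
      (mul_add_lt hi hj) (mul_add_lt hj hi)
  refine (hswap.append
    (Encodes.ite (p := i < j) (fun _ => hbad) fun _ => Encodes.ite (p := j < i) (fun _ => hbad)
      fun _ => Encodes.nil)).congr rfl fun f => and_congr_right fun _ => ?_
  rcases lt_trichotomy i j with h | rfl | h
  · simp [h, h.ne]
  · simp
  · simp [h, h.not_gt, h.ne']

theorem encodes_instanceCode {Γ : Language} (xs is : List (Template Γ)) (k n m L : ℕ) :
    ∃ l, denote x (instanceCode xs is) [L, k, 0, n, m, 0] =
        unary (n * n) ++ unary (k * k + k * k) ++ l ∧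
      Encodes Γ (n * n) (k * k + k * k) l fun f =>
        IsSolution xs is n k (fun a b => x[n + 1 + tri a + b]? = some 1) (value f) := by
  rw [instanceCode, denote_len (length_mulAdd rfl rfl rfl (by simp)),
    denote_len (length_mulAdd rfl rfl rfl (by simp)),
    denote_len (a := k * k + k * k) (by simp [denote, denote_ones]),
    denote_cat]
  refine ⟨(((List.range (k * k)).flatMap fun v => (List.range (n * n)).flatMap fun a =>
      denote x (pair xs 11 6 7 9 10 10 9 10 10)
        [L, k, 0, n, m, 0, n * n, k * k, k * k + k * k, v, a]) ++
    (((List.range k).flatMap fun i => (List.range k).flatMap fun j => (List.range n).flatMap fun a =>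
      denote x (rowConstraints is)
        [L, k, 0, n, m, 0, n * n, k * k, k * k + k * k, i, j, a]) ++
    ((List.range k).flatMap fun i => (List.range k).flatMap fun j => (List.range n).flatMap fun a =>
      (List.range n).flatMap fun b => denote x (cellConstraints is)
        [L, k, 0, n, m, 0, n * n, k * k, k * k + k * k, i, j, a, b]))), ?_,
    (Encodes.range fun v hv => Encodes.range fun a _ => ?_).append
    ((Encodes.range fun i hi => Encodes.range fun j hj => Encodes.range fun a _ =>
      encodes_rowConstraints is hi hj).append
    (Encodes.range fun i hi => Encodes.range fun j hj => Encodes.range fun a _ =>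
      Encodes.range fun b _ => encodes_cellConstraints is hi hj))⟩
  · simp only [denote_cat, denote_ones, unary]
    rfl
  · exact encodes_pair xs rfl rfl rfl rfl rfl rfl rfl rfl rfl
      (by norm_num) (by norm_num) (by norm_num) (by norm_num) (by norm_num) hv hv

open Classical in
theorem flatMap_range_unique {α : Type*} {p : ℕ → Prop} {g : ℕ → List α} {m n : ℕ} (hn : n < m)
    (hp : p n) (huniq : ∀ i, p i → i = n) :
    ((List.range m).flatMap fun i => if p i then g i else []) = g n := by
  induction m, hn using Nat.le_induction with
  | base =>
    rw [flatMap_range_succ, if_pos hp, List.flatMap_eq_nil_iff.2, List.nil_append]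
    intro i hi
    exact if_neg fun h => by have := huniq i h; simp at hi; omega
  | succ m hm ih =>
    rw [flatMap_range_succ, ih, if_neg (fun h => by have := huniq m h; omega), List.append_nil]

open Classical in
theorem denote_reduction {Γ : Language} (xs is : List (Template Γ)) (k : ℕ) :
    denote x (reduction xs is) [x.length, k] = if 0 < k then (List.range x.length).flatMap fun n =>
      if IsGraphCode x n then
        denote x (instanceCode xs is) [x.length, k, 0, n, n + 1 + tri n, 0] else []
      else [] := by
  simp only [← denote_guardCode]
  rfl

end Emitter

/-! ### The reduction from Independent Set -/

theorem nil_notMem_monotoneCSP (Γ : Language) (K : ℕ) : ([], K) ∉ MonotoneCSP Γ := by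
  rintro ⟨I, hI, -⟩
  simp [UdInstance.encode, unary] at hI

/-- Graphs are determined by their encodings. -/
theorem mem_independentSet_iff {n : ℕ} (G : SimpleGraph (Fin n)) {k : ℕ} :
    (encodeGraph G, k) ∈ IndependentSet ↔ 1 ≤ k ∧ ∃ S, G.IsNIndepSet k S := by
  refine and_congr_right fun _ => ⟨?_, fun h => ⟨n, G, rfl, h⟩⟩
  rintro ⟨n', G', hG, h⟩
  obtain ⟨h1, h2⟩ := isGraphCode_encodeGraph G
  obtain ⟨h1', h2'⟩ := isGraphCode_encodeGraph G'
  change encodeGraph G = encodeGraph G' at hG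
  rw [← hG] at h1' h2'
  obtain rfl := h1.unique h1'
  have : G = G' := by
    ext u v
    rcases lt_trichotomy u v with huv | rfl | huv
    · rw [← h2 u v huv, ← h2' u v huv]
    · simp
    · rw [G.adj_comm, G'.adj_comm, ← h2 v u huv, ← h2' v u huv]
  rwa [this]

open Classical in
/-- The reduction to `2 * k²` variables. -/
theorem fptReducible_independentSet {Γ : Language} (hrev : DomainReversible Γ)
    (hcon : ¬ ConnectorProperty Γ) : FPTReducible IndependentSet (MonotoneCSP Γ) := by
  obtain ⟨xs, hxs⟩ := exists_xorTemplates hrev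
  obtain ⟨is, his⟩ := exists_iffTemplates hcon
  -- The last argument of `mulAdd` is the reserved level, which has value `0`.
  have hlen : ∀ (x : List (Fin 2)) (k : ℕ), ((Emitter.cat (.mulAdd 1 1 2) (.mulAdd 1 1 2)).denote x
      [x.length, k, 0]).length = k * k + k * k := by
    intro x k
    rw [Emitter.denote_cat, List.length_append, Emitter.length_mulAdd rfl rfl rfl (by simp)]
    rfl
  refine ⟨_, fun I => ?_, computableInFPTTime_denote (.reduction xs is)
    (.cat (.mulAdd 1 1 2) (.mulAdd 1 1 2)), fun k => k * k + k * k, computable_add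
    (computable_mul Computable.id Computable.id) (computable_mul Computable.id Computable.id),
    fun x k => (hlen x k).le⟩
  obtain ⟨x, k⟩ := I
  simp only [hlen, Emitter.denote_reduction]
  by_cases hk : 0 < k
  · rw [if_pos hk]
    by_cases hx : ∃ n, IsGraphCode x n
    · obtain ⟨n, hn⟩ := hx
      have hnx : n < x.length := by have := hn.length_eq; omega
      rw [Emitter.flatMap_range_unique hnx hn fun i hi => hi.unique hn]
      obtain ⟨l, hl, hS⟩ := Emitter.encodes_instanceCode (x := x) xs is k n (n + 1 + tri n) x.length
      rw [hl, hS.mem_monotoneCSP_iff]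
      obtain ⟨G, rfl⟩ := hn.exists_graph
      have hE := (isGraphCode_encodeGraph G).2
      rw [mem_independentSet_iff]
      constructor
      · rintro ⟨-, S, hS⟩
        exact exists_isSolution hxs his hE hk hS
      · rintro ⟨f, hf⟩
        refine ⟨hk, IsSolution.exists_isNIndepSet hxs his hE (fun v hv => ?_) hf⟩
        rw [value_of_lt f hv]
        exact (f _).2
    · have hnil : ((List.range x.length).flatMap fun n => if IsGraphCode x n then
          (Emitter.instanceCode xs is).denote x [x.length, k, 0, n, n + 1 + tri n, 0] else []) = [] :=
        List.flatMap_eq_nil_iff.2 fun n _ => if_neg fun h => hx ⟨n, h⟩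
      rw [hnil]
      refine iff_of_false ?_ (nil_notMem_monotoneCSP Γ _)
      rintro ⟨-, n, G, hG, -⟩
      change x = encodeGraph G at hG
      exact hx ⟨n, hG ▸ (isGraphCode_encodeGraph G).1⟩
  · rw [if_neg hk]
    exact iff_of_false (fun h => hk h.1) (nil_notMem_monotoneCSP Γ _)

end MonoCSP

theorem mainTheorem2 (Γ : MonoCSP.Language) (hrev : MonoCSP.DomainReversible Γ)
    (hcon : ¬ MonoCSP.ConnectorProperty Γ) :
    MonoCSP.W1Hard (MonoCSP.MonotoneCSP Γ) :=
  fun _ _ h => MonoCSP.FPTReducible.trans h (MonoCSP.fptReducible_independentSet hrev hcon)
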